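/- Let $A\in\mathrm{SL}(2,\mathbb Z)$ be hyperbolic, i.e. $|\mathrm{Tr}(A)|>2$. For odd $N$ let $\mathcal H_N=L^2(\mathbb Z/N\mathbb Z)$ with inner product $\langle\phi,\psi\rangle=\frac1N\sum_{y}\phi(y)\overline{\psi(y)}$, let $T_N(n)\psi(y)=e^{\pi i n_1n_2/N}\,e^{2\pi i n_2y/N}\,\psi(y+n_1)$ for $n\in\mathbb Z^2$, and for $f\in C^\infty(\mathbb T^2)$, $\mathbb T^2=\mathbb R^2/\mathbb Z^2$, let $\mathrm{Op}_N(f)=\sum_{n\in\mathbb Z^2}\hat f(n)T_N(n)$. Let $U_N$ be the quantum propagator, the unitary representation of $\mathrm{SL}(2,\mathbb Z/N\mathbb Z)$ on $\mathcal H_N$ satisfying $U_N(B)^*\,\tilde T_N(n)\,U_N(B)=\tilde T_N(nB)$ for all $n$ and $B$, where $\tilde T_N(n)=(-1)^{n_1n_2}T_N(n)$ (which depends only on $n$ modulo $N$); the operators $U_N(B)$ are determined by this relation up to scalars of modulus one. A Hecke eigenfunction is a $\psi\in\mathcal H_N$ with $\langle\psi,\psi\rangle=1$ that is an eigenvector of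 $U_N(B)$ for every $B\in\mathrm{SL}(2,\mathbb Z/N\mathbb Z)$ with $AB\equiv BA \pmod N$. Then there are a real-valued observable $f\in C^\infty(\mathbb T^2)$, a constant $c>0$ and $p_0$ such that for every prime $p\ge p_0$, with $N=p^3$, there is a Hecke eigenfunction $\psi\in\mathcal H_N$ with $$\Bigl|\langle \mathrm{Op}_N(f)\psi,\psi\rangle-\int_{\mathbb T^2}f\,dx\Bigr|\ \ge\ c\,N^{-1/3}.$$ In particular the matrix elements along such a sequence decay more slowly than the rate $N^{-1/2+\epsilon}$ for every $0<\epsilon<1/6$. -/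

import Mathlib

noncomputable section

open scoped Matrix

set_option linter.unusedSectionVars false

namespace CatMap

/-! ### Observables on the torus `𝕋² = ℝ²/ℤ²` -/

/-- The torus `𝕋² = (ℝ/ℤ)²`. -/
abbrev Torus : Type := UnitAddTorus (Fin 2)

/-- `f ∈ C^∞(𝕋²)`: the associated `ℤ²`-periodic function on `ℝ²` is smooth. -/
def IsSmooth (f : Torus → ℝ) : Prop :=
  ContDiff ℝ (⊤ : ℕ∞) fun x : Fin 2 → ℝ => f fun i => (x i : UnitAddCircle)

/-- The phase space average `∫_{𝕋²} f`, with respect to the normalised Haar measure. -/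
def average (f : Torus → ℝ) : ℝ :=
  ∫ x, f x ∂(MeasureTheory.Measure.pi fun _ : Fin 2 => AddCircle.haarAddCircle (T := (1 : ℝ)))

variable (N : ℕ) [NeZero N]

/-! ### Quantum kinematics: the state space `L²(ℤ/Nℤ)` and the observables -/

/-- The inner product `⟨φ, ψ⟩ = (1/N) ∑_y φ(y) conj(ψ(y))` of `L²(ℤ/Nℤ)`. -/
def stateInner (φ ψ : ZMod N → ℂ) : ℂ :=
  (1 / (N : ℂ)) * ∑ y, φ y * starRingEnd ℂ (ψ y)

/-- The elementary operator `T_N(n)`, acting by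
`(T_N(n) ψ)(y) = e_{2N}(n₁ n₂) e_N(n₂ y) ψ(y + n₁)`; here `n₁ = n 0`, `n₂ = n 1`, and
`ZMod.stdAddChar` is the character `e_N(x) = exp(2 π i x / N)`. -/
def elemOp (n : Fin 2 → ℤ) : Matrix (ZMod N) (ZMod N) ℂ :=
  Matrix.of fun y z => if z = y + (n 0 : ZMod N) then
    Complex.exp (2 * Real.pi * Complex.I * ((n 0 : ℂ) * (n 1 : ℂ)) / (2 * (N : ℂ))) *
      ZMod.stdAddChar ((n 1 : ZMod N) * y) else 0

/-- The quantization `Op_N(f) = ∑_{n ∈ ℤ²} f̂(n) T_N(n)`. -/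
def Op (f : Torus → ℝ) : Matrix (ZMod N) (ZMod N) ℂ :=
  ∑' n : Fin 2 → ℤ, UnitAddTorus.mFourierCoeff (fun x => (f x : ℂ)) n • elemOp N n

/-! ### Quantum dynamics: the quantum propagators `U_N(B)`, for odd `N` -/

/-- The twisted elementary operator `(-1)^{n₁ n₂} T_N(n)` for odd `N`; it depends only on `n`
modulo `N`, see `twOp_intCast`. -/
def twOp (n : Fin 2 → ZMod N) : Matrix (ZMod N) (ZMod N) ℂ :=
  Matrix.of fun y z => if z = y + n 0 then
    ZMod.stdAddChar ((2 : ZMod N)⁻¹ * (n 0 * n 1) + n 1 * y) else 0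

/-- The operator `∑_{m ∈ (ℤ/Nℤ)²} T(m) T(-mB)` (with `T` the twisted elementary operators), a
nonzero multiple of the propagator `U_N(B)`. -/
def rawU (B : Matrix.SpecialLinearGroup (Fin 2) (ZMod N)) : Matrix (ZMod N) (ZMod N) ℂ :=
  ∑ m : Fin 2 → ZMod N, twOp N m * twOp N (-(m ᵥ* B.1))

/-- The reflection `ψ(y) ↦ ψ(-y)`. -/
def reflection : Matrix (ZMod N) (ZMod N) ℂ :=
  Matrix.of fun y z => if z = -y then 1 else 0

/-- The projection onto the even functions. -/
def evenProj : Matrix (ZMod N) (ZMod N) ℂ := (1 / 2 : ℂ) • (1 + reflection N)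

/-- The projection onto the odd functions. -/
def oddProj : Matrix (ZMod N) (ZMod N) ℂ := (1 / 2 : ℂ) • (1 - reflection N)

/-- For `V` commuting with the reflection: `det(V | odd functions) / det(V | even functions)`. -/
def detRatio (V : Matrix (ZMod N) (ZMod N) ℂ) : ℂ :=
  (V * oddProj N + evenProj N).det / (V * evenProj N + oddProj N).det

/-- The quantum propagator `U_N(B)`, for odd `N`: the multiple of `∑_m T(m) T(-mB)` whose
determinants on the even functions and on the odd functions are equal. -/
def U (B : Matrix.SpecialLinearGroup (Fin 2) (ZMod N)) : Matrix (ZMod N) (ZMod N) ℂ :=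
  detRatio N (rawU N B) • rawU N B

/-! #### `U_N` is a unitary representation with the exact Egorov property -/

lemma two_inv_mul (hN : Odd N) : (2 : ZMod N)⁻¹ * 2 = 1 := by
  have : IsUnit ((2 : ℕ) : ZMod N) := (ZMod.isUnit_iff_coprime 2 N).2 (by
    simpa using hN)
  simpa using ZMod.inv_mul_of_unit _ this

lemma twOp_intCast (hN : Odd N) (n : Fin 2 → ℤ) :
    twOp N (fun i => (n i : ZMod N)) = ((-1 : ℂ) ^ (n 0 * n 1)) • elemOp N n := by
  obtain ⟨k, hk⟩ := hN
  have hk' : (N : ℂ) = 2 * k + 1 := by exact_mod_cast congrArg (Nat.cast (R := ℂ)) hk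
  have hN0 : (N : ℂ) ≠ 0 := by exact_mod_cast NeZero.ne N
  have h2 : (2 : ZMod N)⁻¹ = (((k : ℤ) + 1 : ℤ) : ZMod N) := by
    have h := two_inv_mul N ⟨k, hk⟩
    have h0 : ((2 * k + 1 : ℕ) : ZMod N) = 0 := by rw [← hk]; simp
    push_cast at h0 ⊢
    linear_combination (k + 1 : ZMod N) * h - (2 : ZMod N)⁻¹ * h0
  ext y z
  simp only [twOp, elemOp, Matrix.of_apply, Matrix.smul_apply, smul_eq_mul, mul_ite, mul_zero]
  split_ifs with h
  · rw [AddChar.map_add_eq_mul]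
    conv_rhs => rw [← mul_assoc]
    congr 1
    rw [h2, ← Int.cast_mul, ← Int.cast_mul, ZMod.stdAddChar_coe, ← Complex.exp_pi_mul_I,
      ← Complex.exp_int_mul, ← Complex.exp_add]
    congr 1
    push_cast
    field_simp
    rw [hk']
    ring
  · rfl

lemma elemOp_mulVec (n : Fin 2 → ℤ) (ψ : ZMod N → ℂ) (y : ZMod N) :
    (elemOp N n *ᵥ ψ) y =
      Complex.exp (2 * Real.pi * Complex.I * ((n 0 : ℂ) * (n 1 : ℂ)) / (2 * (N : ℂ))) *
        ZMod.stdAddChar ((n 1 : ZMod N) * y) * ψ (y + (n 0 : ZMod N)) := by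
  simp [elemOp, Matrix.mulVec, dotProduct]

lemma twOp_mul (hN : Odd N) (m n : Fin 2 → ZMod N) :
    twOp N m * twOp N n =
      ZMod.stdAddChar ((2 : ZMod N)⁻¹ * (m 0 * n 1 - m 1 * n 0)) • twOp N (m + n) := by
  ext y z
  simp only [twOp, Matrix.mul_apply, Matrix.of_apply, Matrix.smul_apply, smul_eq_mul, Pi.add_apply,
    ite_mul, zero_mul, mul_ite, mul_zero]
  rw [Finset.sum_eq_single (y + m 0) (by intros; simp_all) (by simp)]
  simp only [if_true, add_assoc]
  split_ifs
  · rw [← AddChar.map_add_eq_mul, ← AddChar.map_add_eq_mul]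
    congr 1
    linear_combination (-n 1 * m 0) * two_inv_mul N hN
  · rfl

lemma twOp_zero : twOp N 0 = 1 := by
  ext y z
  simp [twOp, Matrix.one_apply, eq_comm]

lemma star_stdAddChar (x : ZMod N) :
    star (ZMod.stdAddChar x : ℂ) = ZMod.stdAddChar (-x) := by
  rw [AddChar.map_neg_eq_inv]
  simp [ZMod.stdAddChar_apply, ← Circle.coe_inv_eq_conj]

lemma twOp_star (hN : Odd N) (n : Fin 2 → ZMod N) : (twOp N n)ᴴ = twOp N (-n) := by
  ext y z
  simp only [twOp, Matrix.conjTranspose_apply, Matrix.of_apply, Pi.neg_apply, apply_ite star,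
    star_zero]
  by_cases h : y = z + n 0
  · have h' : z = y + -n 0 := by rw [h]; ring
    rw [if_pos h, if_pos h', star_stdAddChar]
    congr 1
    rw [h]
    linear_combination (-n 0 * n 1) * two_inv_mul N hN
  · rw [if_neg h, if_neg]
    rintro rfl
    exact h (by ring)

lemma reflection_mul_twOp (n : Fin 2 → ZMod N) :
    reflection N * twOp N n = twOp N (-n) * reflection N := by
  ext y z
  simp only [reflection, twOp, Matrix.mul_apply, Matrix.of_apply, Pi.neg_apply, ite_mul, zero_mul,
    one_mul]
  rw [Finset.sum_eq_single (-y) (by intros; simp_all) (by simp),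
    Finset.sum_eq_single (y + -n 0) (by intros; simp_all) (by simp)]
  have : -(y + -n 0) = -y + n 0 := by ring
  simp only [if_true, this, mul_ite, mul_one, mul_zero]
  congr 2
  ring

lemma symplectic (B : Matrix.SpecialLinearGroup (Fin 2) (ZMod N)) (m n : Fin 2 → ZMod N) :
    (m ᵥ* B.1) 0 * (n ᵥ* B.1) 1 - (m ᵥ* B.1) 1 * (n ᵥ* B.1) 0 = m 0 * n 1 - m 1 * n 0 := by
  have h := B.2
  rw [Matrix.det_fin_two] at h
  simp only [Matrix.vecMul, dotProduct, Fin.sum_univ_two]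
  linear_combination (m 0 * n 1 - m 1 * n 0) * h

lemma twOp_mul_rawU (hN : Odd N) (B : Matrix.SpecialLinearGroup (Fin 2) (ZMod N))
    (n : Fin 2 → ZMod N) : twOp N n * rawU N B = rawU N B * twOp N (n ᵥ* B.1) := by
  rw [rawU, Finset.mul_sum, Finset.sum_mul]
  conv_rhs => rw [← Equiv.sum_comp (Equiv.addRight n)]
  refine Finset.sum_congr rfl fun m _ => ?_
  simp only [Equiv.coe_addRight, mul_assoc]
  rw [twOp_mul N hN (-((m + n) ᵥ* B.1)), ← mul_assoc, twOp_mul N hN n m, Matrix.smul_mul,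
    Matrix.mul_smul, add_comm n m, Matrix.add_vecMul, neg_add, add_assoc, neg_add_cancel, add_zero]
  congr 2
  have := symplectic N B m n
  simp only [Pi.neg_apply, Pi.add_apply]
  linear_combination (2 : ZMod N)⁻¹ * this

lemma eq_smul_one (V : Matrix (ZMod N) (ZMod N) ℂ) (h : ∀ n, twOp N n * V = V * twOp N n) :
    ∃ s : ℂ, V = s • 1 := by
  refine ⟨V 0 0, ?_⟩
  have h1 : ∀ y z, (ZMod.stdAddChar y : ℂ) * V y z = V y z * ZMod.stdAddChar z := by
    intro y z
    have := congrFun (congrFun (h ![0, 1]) y) z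
    simpa [twOp, Matrix.mul_apply] using this
  have h2 : ∀ a y z, V (y + a) z = V y (z - a) := by
    intro a y z
    have := congrFun (congrFun (h ![a, 0]) y) z
    simp only [twOp, Matrix.mul_apply, Matrix.of_apply] at this
    rw [Finset.sum_eq_single (y + a) (by intros; simp_all) (by simp),
      Finset.sum_eq_single (z - a) (by
        intro b _ hb
        have : ¬ z = b + a := fun h => hb (by rw [h]; ring)
        simp [this]) (by simp)] at this
    simpa using this
  ext y z
  by_cases hyz : y = z
  · subst hyz
    have := h2 y 0 y
    simpa using this
  · have := h1 y z
    have hne : (ZMod.stdAddChar y : ℂ) ≠ ZMod.stdAddChar z :=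
      fun h => hyz (ZMod.injective_stdAddChar h)
    have : V y z = 0 := by
      have h3 : ((ZMod.stdAddChar y : ℂ) - ZMod.stdAddChar z) * V y z = 0 := by
        linear_combination this
      exact (mul_eq_zero.1 h3).resolve_left (sub_ne_zero.2 hne)
    simp [this, hyz]

lemma trace_twOp (n : Fin 2 → ZMod N) :
    (twOp N n).trace = if n = 0 then (N : ℂ) else 0 := by
  simp only [Matrix.trace, Matrix.diag, twOp, Matrix.of_apply]
  by_cases h0 : n 0 = 0
  · simp only [h0, add_zero, if_true, zero_mul, mul_zero, zero_add]
    simp_rw [mul_comm (n 1)]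
    rw [AddChar.sum_mulShift _ (ZMod.isPrimitive_stdAddChar N)]
    by_cases h1 : n 1 = 0
    · have : n = 0 := by ext i; fin_cases i <;> simp [h0, h1]
      simp [this, ZMod.card]
    · have : n ≠ 0 := fun h => h1 (by simp [h])
      simp [this, h1]
  · have : n ≠ 0 := fun h => h0 (by simp [h])
    simp [this, h0]

lemma rawU_ne_zero (hN : Odd N) (B : Matrix.SpecialLinearGroup (Fin 2) (ZMod N)) :
    rawU N B ≠ 0 := by
  intro h
  have ht : (rawU N B).trace = ∑ m : Fin 2 → ZMod N, if m + -(m ᵥ* B.1) = 0 then (N : ℂ) else 0 := by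
    rw [rawU, Matrix.trace_sum]
    refine Finset.sum_congr rfl fun m _ => ?_
    rw [twOp_mul N hN, Matrix.trace_smul, trace_twOp]
    split_ifs with hm
    · have : m ᵥ* B.1 = m := by
        rw [← sub_eq_add_neg, sub_eq_zero] at hm
        exact hm.symm
      rw [this]
      have h0 : m 0 * (-m) 1 - m 1 * (-m) 0 = 0 := by simp only [Pi.neg_apply]; ring
      rw [h0, mul_zero, AddChar.map_zero_eq_one, one_smul]
    · simp
  rw [h, Matrix.trace_zero, ← Finset.sum_filter, Finset.sum_const, nsmul_eq_mul, eq_comm,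
    mul_eq_zero] at ht
  rcases ht with ht | ht
  · have : (0 : Fin 2 → ZMod N) ∈ Finset.univ.filter
        fun m : Fin 2 → ZMod N => m + -(m ᵥ* B.1) = 0 := by simp
    have h2 := Finset.card_pos.2 ⟨_, this⟩
    exact h2.ne' (by exact_mod_cast ht)
  · exact NeZero.ne N (by exact_mod_cast ht)

lemma rawU_star (hN : Odd N) (B : Matrix.SpecialLinearGroup (Fin 2) (ZMod N)) :
    (rawU N B)ᴴ = rawU N B⁻¹ := by
  have hB : B.1 * (B⁻¹).1 = 1 := by
    rw [← Matrix.SpecialLinearGroup.coe_mul, mul_inv_cancel, Matrix.SpecialLinearGroup.coe_one]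
  have hB' : (B⁻¹).1 * B.1 = 1 := by
    rw [← Matrix.SpecialLinearGroup.coe_mul, inv_mul_cancel, Matrix.SpecialLinearGroup.coe_one]
  let e : (Fin 2 → ZMod N) ≃ (Fin 2 → ZMod N) :=
    { toFun := fun m => m ᵥ* B.1
      invFun := fun m => m ᵥ* (B⁻¹).1
      left_inv := fun m => by simp only [Matrix.vecMul_vecMul, hB, Matrix.vecMul_one]
      right_inv := fun m => by simp only [Matrix.vecMul_vecMul, hB', Matrix.vecMul_one] }
  rw [rawU, rawU, Matrix.conjTranspose_sum]
  conv_rhs => rw [← Equiv.sum_comp e]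
  refine Finset.sum_congr rfl fun m _ => ?_
  rw [Matrix.conjTranspose_mul, twOp_star N hN, twOp_star N hN, neg_neg]
  simp only [e, Equiv.coe_fn_mk, Matrix.vecMul_vecMul, hB, Matrix.vecMul_one]

lemma rawU_mul_star (hN : Odd N) (B : Matrix.SpecialLinearGroup (Fin 2) (ZMod N)) :
    ∃ s : ℂ, s ≠ 0 ∧ rawU N B * (rawU N B)ᴴ = s • 1 := by
  have hB : B.1 * (B⁻¹).1 = 1 := by
    rw [← Matrix.SpecialLinearGroup.coe_mul, mul_inv_cancel, Matrix.SpecialLinearGroup.coe_one]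
  obtain ⟨s, hs⟩ := eq_smul_one N (rawU N B * (rawU N B)ᴴ) (fun n => by
    rw [rawU_star N hN, ← mul_assoc, twOp_mul_rawU N hN, mul_assoc, twOp_mul_rawU N hN,
      Matrix.vecMul_vecMul, hB, Matrix.vecMul_one, mul_assoc])
  refine ⟨s, ?_, hs⟩
  rintro rfl
  refine rawU_ne_zero N hN B ?_
  ext y z
  have h0 := congrFun (congrFun hs y) y
  simp only [Matrix.mul_apply, Matrix.conjTranspose_apply, zero_smul, Matrix.zero_apply,
    Complex.star_def, Complex.mul_conj, ← Complex.ofReal_sum] at h0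
  have h1 := (Finset.sum_eq_zero_iff_of_nonneg fun i _ => Complex.normSq_nonneg _).1
    (Complex.ofReal_eq_zero.1 h0) z (Finset.mem_univ z)
  simpa using h1

lemma isUnit_rawU (hN : Odd N) (B : Matrix.SpecialLinearGroup (Fin 2) (ZMod N)) :
    IsUnit (rawU N B) := by
  obtain ⟨s, hs, h⟩ := rawU_mul_star N hN B
  refine IsUnit.of_mul_eq_one (s⁻¹ • (rawU N B)ᴴ) ?_
  rw [Matrix.mul_smul, h, smul_smul, inv_mul_cancel₀ hs, one_smul]

lemma rawU_mul (hN : Odd N) (B C : Matrix.SpecialLinearGroup (Fin 2) (ZMod N)) :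
    ∃ s : ℂ, s ≠ 0 ∧ rawU N B * rawU N C = s • rawU N (B * C) := by
  obtain ⟨t, ht, h⟩ := rawU_mul_star N hN (B * C)
  have hinv : (B * C).1 * ((B * C)⁻¹).1 = 1 := by
    rw [← Matrix.SpecialLinearGroup.coe_mul, mul_inv_cancel, Matrix.SpecialLinearGroup.coe_one]
  obtain ⟨s, hs⟩ := eq_smul_one N (rawU N B * rawU N C * (rawU N (B * C))ᴴ) (fun n => by
    rw [rawU_star N hN, ← mul_assoc, ← mul_assoc, twOp_mul_rawU N hN, mul_assoc (rawU N B),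
      twOp_mul_rawU N hN, mul_assoc, mul_assoc (rawU N C), twOp_mul_rawU N hN,
      Matrix.vecMul_vecMul, Matrix.vecMul_vecMul, ← mul_assoc B.1,
      ← Matrix.SpecialLinearGroup.coe_mul B C, hinv, Matrix.vecMul_one]
    simp only [mul_assoc])
  have h' : (rawU N (B * C))ᴴ * rawU N (B * C) = t • 1 := by
    have h1 : rawU N (B * C) * (t⁻¹ • (rawU N (B * C))ᴴ) = 1 := by
      rw [Matrix.mul_smul, h, smul_smul, inv_mul_cancel₀ ht, one_smul]
    rw [mul_eq_one_comm, Matrix.smul_mul] at h1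
    rw [← h1, smul_smul, mul_inv_cancel₀ ht, one_smul]
  have key : t • (rawU N B * rawU N C) = s • rawU N (B * C) := by
    have := congrArg (· * rawU N (B * C)) hs
    simpa [mul_assoc, h', Matrix.mul_smul, Matrix.smul_mul] using this
  have key' : rawU N B * rawU N C = (t⁻¹ * s) • rawU N (B * C) := by
    rw [← smul_smul, ← key, smul_smul, inv_mul_cancel₀ ht, one_smul]
  refine ⟨t⁻¹ * s, ?_, key'⟩
  intro h0
  rw [h0, zero_smul] at key'
  exact ((isUnit_rawU N hN B).mul (isUnit_rawU N hN C)).ne_zero key'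

lemma reflection_mul_self : reflection N * reflection N = 1 := by
  ext y z
  simp only [reflection, Matrix.mul_apply, Matrix.of_apply, ite_mul, zero_mul, one_mul]
  rw [Finset.sum_eq_single (-y) (by intros; simp_all) (by simp)]
  simp [Matrix.one_apply, eq_comm]

lemma reflection_star : (reflection N)ᴴ = reflection N := by
  ext y z
  simp only [reflection, Matrix.conjTranspose_apply, Matrix.of_apply, apply_ite star, star_one,
    star_zero]
  congr 1
  exact propext ⟨fun h => by rw [h, neg_neg], fun h => by rw [h, neg_neg]⟩

lemma reflection_mul_rawU (B : Matrix.SpecialLinearGroup (Fin 2) (ZMod N)) :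
    reflection N * rawU N B = rawU N B * reflection N := by
  rw [rawU, Finset.mul_sum, Finset.sum_mul, ← Equiv.sum_comp (Equiv.neg _)]
  refine Finset.sum_congr rfl fun m _ => ?_
  rw [Equiv.neg_apply, ← mul_assoc, reflection_mul_twOp, mul_assoc, reflection_mul_twOp, neg_neg,
    Matrix.neg_vecMul, neg_neg, mul_assoc]

lemma even_mul_even : evenProj N * evenProj N = evenProj N := by
  simp only [evenProj, Matrix.smul_mul, Matrix.mul_smul, mul_add, add_mul, mul_one,
    one_mul, reflection_mul_self]
  module

lemma odd_mul_odd : oddProj N * oddProj N = oddProj N := by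
  simp only [oddProj, Matrix.smul_mul, Matrix.mul_smul, mul_sub, sub_mul, mul_one,
    one_mul, reflection_mul_self]
  module

lemma even_mul_odd : evenProj N * oddProj N = 0 := by
  simp only [evenProj, oddProj, Matrix.smul_mul, Matrix.mul_smul, mul_sub, add_mul,
    mul_one, one_mul, reflection_mul_self]
  module

lemma odd_mul_even : oddProj N * evenProj N = 0 := by
  simp only [evenProj, oddProj, Matrix.smul_mul, Matrix.mul_smul, mul_add, sub_mul,
    mul_one, one_mul, reflection_mul_self]
  module

lemma even_add_odd : evenProj N + oddProj N = 1 := by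
  simp only [evenProj, oddProj]
  module

section

variable {N}
variable {V W : Matrix (ZMod N) (ZMod N) ℂ}

lemma comm_even (hV : reflection N * V = V * reflection N) :
    evenProj N * V = V * evenProj N := by
  simp only [evenProj, Matrix.smul_mul, Matrix.mul_smul, mul_add, add_mul, mul_one, one_mul, hV]

lemma comm_odd (hV : reflection N * V = V * reflection N) :
    oddProj N * V = V * oddProj N := by
  simp only [oddProj, Matrix.smul_mul, Matrix.mul_smul, mul_sub, sub_mul, mul_one, one_mul, hV]

lemma even_block_mul (hW : reflection N * W = W * reflection N) :
    (V * evenProj N + oddProj N) * (W * evenProj N + oddProj N) =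
      V * W * evenProj N + oddProj N := by
  have h1 : V * evenProj N * (W * evenProj N) = V * W * evenProj N := by
    rw [mul_assoc, ← mul_assoc (evenProj N), comm_even hW, mul_assoc W, even_mul_even, mul_assoc]
  have h2 : oddProj N * (W * evenProj N) = 0 := by
    rw [← mul_assoc, comm_odd hW, mul_assoc, odd_mul_even, mul_zero]
  rw [mul_add, add_mul, add_mul, h1, h2, mul_assoc V (evenProj N), even_mul_odd, odd_mul_odd]
  simp

lemma odd_block_mul (hW : reflection N * W = W * reflection N) :
    (V * oddProj N + evenProj N) * (W * oddProj N + evenProj N) =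
      V * W * oddProj N + evenProj N := by
  have h1 : V * oddProj N * (W * oddProj N) = V * W * oddProj N := by
    rw [mul_assoc, ← mul_assoc (oddProj N), comm_odd hW, mul_assoc W, odd_mul_odd, mul_assoc]
  have h2 : evenProj N * (W * oddProj N) = 0 := by
    rw [← mul_assoc, comm_even hW, mul_assoc, even_mul_odd, mul_zero]
  rw [mul_add, add_mul, add_mul, h1, h2, mul_assoc V (oddProj N), odd_mul_even, even_mul_even]
  simp

lemma detRatio_mul (hW : reflection N * W = W * reflection N) :
    detRatio N (V * W) = detRatio N V * detRatio N W := by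
  rw [detRatio, detRatio, detRatio, ← even_block_mul hW, ← odd_block_mul hW, Matrix.det_mul,
    Matrix.det_mul, mul_div_mul_comm]

lemma even_block_mul_odd_block (hV : reflection N * V = V * reflection N) :
    (V * evenProj N + oddProj N) * (V * oddProj N + evenProj N) = V := by
  have h1 : V * evenProj N * (V * oddProj N) = 0 := by
    rw [mul_assoc, ← mul_assoc (evenProj N), comm_even hV, mul_assoc, even_mul_odd, mul_zero,
      mul_zero]
  have h2 : oddProj N * (V * oddProj N) = V * oddProj N := by
    rw [← mul_assoc, comm_odd hV, mul_assoc, odd_mul_odd]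
  rw [mul_add, add_mul, add_mul, h1, h2, mul_assoc V, even_mul_even, odd_mul_even, zero_add,
    add_zero, ← mul_add, add_comm (oddProj N), even_add_odd, mul_one]

lemma detRatio_star (hV : reflection N * V = V * reflection N) :
    detRatio N Vᴴ = star (detRatio N V) := by
  have he : (evenProj N)ᴴ = evenProj N := by
    simp [evenProj, Matrix.conjTranspose_smul, reflection_star]
  have ho : (oddProj N)ᴴ = oddProj N := by
    simp [oddProj, Matrix.conjTranspose_smul, reflection_star]
  have h1 : Vᴴ * evenProj N + oddProj N = (V * evenProj N + oddProj N)ᴴ := by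
    rw [← comm_even hV, Matrix.conjTranspose_add, Matrix.conjTranspose_mul, he, ho]
  have h2 : Vᴴ * oddProj N + evenProj N = (V * oddProj N + evenProj N)ᴴ := by
    rw [← comm_odd hV, Matrix.conjTranspose_add, Matrix.conjTranspose_mul, he, ho]
  rw [detRatio, detRatio, h1, h2, Matrix.det_conjTranspose, Matrix.det_conjTranspose, star_div₀]

end

lemma detRatio_smul_one (hN : Odd N) {s : ℂ} (hs : s ≠ 0) :
    detRatio N (s • 1) = s⁻¹ := by
  obtain ⟨k, hk⟩ := hN
  -- the half system of the `y` with `1 ≤ y ≤ (N - 1) / 2`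
  let d : ZMod N → ℂ := fun y => if y.val ∈ Finset.Icc 1 k then 1 else 0
  have hneg : ∀ y : ZMod N, y ≠ 0 → (-y).val = N - y.val := fun y hy => by
    rw [ZMod.neg_val, if_neg hy]
  have hd0 : d 0 = 0 := by simp [d]
  have hval : ∀ y : ZMod N, y ≠ 0 → 1 ≤ y.val ∧ y.val < N := fun y hy =>
    ⟨Nat.one_le_iff_ne_zero.2 (by simpa using hy), ZMod.val_lt y⟩
  have hd : ∀ y : ZMod N, y ≠ 0 → d y + d (-y) = 1 ∧ d y * d (-y) = 0 := fun y hy => by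
    have h1 := hval y hy
    simp only [d, hneg y hy, Finset.mem_Icc]
    by_cases h : y.val ≤ k
    · rw [if_pos ⟨h1.1, h⟩, if_neg (by omega)]; simp
    · rw [if_neg (by omega), if_pos (by omega)]; simp
  have hdd : ∀ y, d y * d y = d y := fun y => by simp only [d]; split_ifs <;> simp
  let X := (1 - reflection N) * Matrix.diagonal d
  let Y := (1 / 2 : ℂ) • (Matrix.diagonal d * (1 - reflection N))
  have hentry : ∀ (a b : ZMod N → ℂ) (y z : ZMod N),
      (Matrix.diagonal a * reflection N * Matrix.diagonal b) y z =
        if z = -y then a y * b z else 0 := fun a b y z => by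
    rw [Matrix.mul_diagonal, Matrix.diagonal_mul]
    simp only [reflection, Matrix.of_apply]
    split_ifs <;> simp
  have hDRD : Matrix.diagonal d * reflection N * Matrix.diagonal d = 0 := by
    ext y z
    rw [hentry]
    split_ifs with h
    · subst h
      by_cases hy : y = 0
      · simp [hy, hd0]
      · simp [(hd y hy).2]
    · rfl
  have hYX : Y * X = Matrix.diagonal d := by
    have h1 : (1 - reflection N) * (1 - reflection N) = (2 : ℂ) • (1 - reflection N) := by
      rw [mul_sub, sub_mul, sub_mul, reflection_mul_self]
      simp only [mul_one, one_mul]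
      module
    have h2 : Matrix.diagonal d * Matrix.diagonal d = Matrix.diagonal d := by
      rw [Matrix.diagonal_mul_diagonal]; congr 1; ext y; exact hdd y
    calc Y * X = (1 / 2 : ℂ) • (Matrix.diagonal d * ((1 - reflection N) * (1 - reflection N)) *
          Matrix.diagonal d) := by simp only [X, Y, Matrix.smul_mul, mul_assoc]
      _ = Matrix.diagonal d := by
        rw [h1, Matrix.mul_smul, Matrix.smul_mul, smul_smul, mul_sub, sub_mul, hDRD, mul_one, h2]
        simp
  have hXY : X * Y = oddProj N := by
    have h2 : Matrix.diagonal d * Matrix.diagonal d = Matrix.diagonal d := by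
      rw [Matrix.diagonal_mul_diagonal]; congr 1; ext y; exact hdd y
    have h3 : X * Y = (1 / 2 : ℂ) • ((1 - reflection N) * Matrix.diagonal d *
        (1 - reflection N)) := by
      simp only [X, Y, Matrix.mul_smul]
      rw [mul_assoc, ← mul_assoc (Matrix.diagonal d), h2, mul_assoc]
    rw [h3, oddProj]
    congr 1
    ext y z
    have hR : ∀ (M : Matrix (ZMod N) (ZMod N) ℂ) y z, (reflection N * M) y z = M (-y) z :=
      fun M y z => by simp [reflection, Matrix.mul_apply]
    have hR' : ∀ (M : Matrix (ZMod N) (ZMod N) ℂ) y z, (M * reflection N) y z = M y (-z) :=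
      fun M y z => by
        rw [Matrix.mul_apply, Finset.sum_eq_single (-z)]
        · simp [reflection]
        · intro b _ hb
          have : ¬ z = -b := fun h => hb (by rw [h, neg_neg])
          simp [reflection, this]
        · simp
    simp only [mul_sub, sub_mul, mul_one, one_mul, Matrix.sub_apply, hR, hR']
    simp only [Matrix.diagonal_apply, Matrix.one_apply, reflection, Matrix.of_apply, neg_inj]
    by_cases hy : y = 0
    · subst hy
      by_cases hz : z = 0
      · simp [hz, hd0]
      · simp [hz, eq_comm]
    · have := (hd y hy).1
      have hyy : ¬ y = -y := fun h => by
        have h1 := (hd y hy).1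
        have h2 := (hd y hy).2
        rw [← h] at h1 h2
        rw [hdd] at h2
        simp [h2] at h1
      by_cases hz : z = y
      · subst hz
        have : ¬ -z = z := fun h => hyy h.symm
        simp only [hyy, this, if_true, if_false]
        linear_combination (hd z hy).1
      · by_cases hz' : z = -y
        · subst hz'
          simp only [neg_neg, hyy, if_true, if_false]
          linear_combination -(hd y hy).1
        · have h4 : ¬ y = z := fun h => hz h.symm
          have h5 : ¬ -y = z := fun h => hz' h.symm
          have h6 : ¬ y = -z := fun h => hz' (by rw [h, neg_neg])
          simp [h4, h5, h6, hz']
  have hcard : 2 * (Finset.univ.filter fun y : ZMod N => y.val ∈ Finset.Icc 1 k).card + 1 = N := by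
    have h1 : (2 : ℂ) * ∑ y, d y + 1 = N := by
      have h2 : ∑ y : ZMod N, d (-y) = ∑ y, d y := Equiv.sum_comp (Equiv.neg _) d
      have h3 : ∑ y : ZMod N, (d y + d (-y) + if y = 0 then 1 else 0) = N := by
        rw [Finset.sum_congr rfl (g := fun _ => (1 : ℂ))]
        · simp [ZMod.card]
        · intro y _
          by_cases hy : y = 0
          · simp [hy, hd0]
          · simp [hy, (hd y hy).1]
      rw [Finset.sum_add_distrib, Finset.sum_add_distrib, h2] at h3
      simp only [Finset.sum_ite_eq', Finset.mem_univ, if_true] at h3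
      linear_combination h3
    simp only [d, Finset.sum_boole] at h1
    exact_mod_cast h1
  set r := (Finset.univ.filter fun y : ZMod N => y.val ∈ Finset.Icc 1 k).card with hr
  have hodd : ((s • (1 : Matrix (ZMod N) (ZMod N) ℂ)) * oddProj N + evenProj N).det = s ^ r := by
    have h1 : (s • (1 : Matrix (ZMod N) (ZMod N) ℂ)) * oddProj N + evenProj N =
        1 + ((s - 1) • X) * Y := by
      rw [Matrix.smul_mul, Matrix.smul_mul, one_mul, hXY, ← even_add_odd N]
      module
    rw [h1, Matrix.det_one_add_mul_comm, Matrix.mul_smul, hYX, ← Matrix.diagonal_one,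
      ← Matrix.diagonal_smul, Matrix.diagonal_add, Matrix.det_diagonal, hr, ← Finset.prod_const,
      Finset.prod_filter]
    refine Finset.prod_congr rfl fun y _ => ?_
    simp only [d, Pi.smul_apply, smul_eq_mul]
    split_ifs <;> simp
  have hprod : ((s • (1 : Matrix (ZMod N) (ZMod N) ℂ)) * evenProj N + oddProj N).det * s ^ r =
      s ^ N := by
    rw [← hodd, ← Matrix.det_mul, even_block_mul_odd_block (by simp), Matrix.det_smul,
      Matrix.det_one, mul_one, ZMod.card]
  have hN' : s ^ N = s ^ r * s ^ r * s := by
    conv_lhs => rw [← hcard]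
    ring
  have hsr : s ^ r ≠ 0 := pow_ne_zero _ hs
  have heven : ((s • (1 : Matrix (ZMod N) (ZMod N) ℂ)) * evenProj N + oddProj N).det =
      s ^ r * s := by
    apply mul_right_cancel₀ hsr
    rw [hprod, hN']
    ring
  rw [detRatio, hodd, heven]
  field_simp

lemma detRatio_smul (hN : Odd N) {s : ℂ} (hs : s ≠ 0) (V : Matrix (ZMod N) (ZMod N) ℂ)
    (hV : reflection N * V = V * reflection N) :
    detRatio N (s • V) = s⁻¹ * detRatio N V := by
  rw [← detRatio_smul_one N hN hs, ← detRatio_mul hV, Matrix.smul_mul, one_mul]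

theorem U_mul (hN : Odd N) (B C : Matrix.SpecialLinearGroup (Fin 2) (ZMod N)) :
    U N (B * C) = U N B * U N C := by
  obtain ⟨s, hs, h⟩ := rawU_mul N hN B C
  have hC := reflection_mul_rawU N C
  have hBC := reflection_mul_rawU N (B * C)
  rw [U, U, U, Matrix.smul_mul, Matrix.mul_smul, smul_smul, ← detRatio_mul hC, h,
    detRatio_smul N hN hs _ hBC, smul_smul]
  congr 1
  field_simp

/-- `U_N(B)` is unitary. -/
theorem U_mul_star (hN : Odd N) (B : Matrix.SpecialLinearGroup (Fin 2) (ZMod N)) :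
    U N B * (U N B)ᴴ = 1 := by
  obtain ⟨s, hs, h⟩ := rawU_mul_star N hN B
  have hB := reflection_mul_rawU N B
  have hB' : reflection N * (rawU N B)ᴴ = (rawU N B)ᴴ * reflection N := by
    rw [rawU_star N hN, reflection_mul_rawU]
  rw [U, Matrix.conjTranspose_smul, ← detRatio_star hB, Matrix.smul_mul, Matrix.mul_smul,
    smul_smul, ← detRatio_mul hB', h, detRatio_smul_one N hN hs, smul_smul, inv_mul_cancel₀ hs,
    one_smul]

theorem U_one (hN : Odd N) : U N 1 = 1 := by
  have h := U_mul N hN 1 1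
  have h2 := U_mul_star N hN 1
  rw [mul_one] at h
  calc U N 1 = U N 1 * (U N 1 * (U N 1)ᴴ) := by rw [h2, mul_one]
    _ = 1 := by rw [← mul_assoc, ← h, h2]

/-- The exact Egorov property `U_N(B)* T(n) U_N(B) = T(nB)` of the twisted elementary operators. -/
theorem U_egorov (hN : Odd N) (B : Matrix.SpecialLinearGroup (Fin 2) (ZMod N))
    (n : Fin 2 → ZMod N) : (U N B)ᴴ * twOp N n * U N B = twOp N (n ᵥ* B.1) := by
  have h : twOp N n * U N B = U N B * twOp N (n ᵥ* B.1) := by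
    rw [U, Matrix.mul_smul, Matrix.smul_mul, twOp_mul_rawU N hN]
  rw [mul_assoc, h, ← mul_assoc, mul_eq_one_comm.1 (U_mul_star N hN B), one_mul]

/-! ### Hecke eigenfunctions -/

/-- The Hecke group `C(N)`: the `B ∈ SL(2, ℤ/Nℤ)` with `AB = BA` modulo `N`. -/
def heckeGroup (A : Matrix.SpecialLinearGroup (Fin 2) ℤ) :
    Subgroup (Matrix.SpecialLinearGroup (Fin 2) (ZMod N)) :=
  Subgroup.centralizer {Matrix.SpecialLinearGroup.map (Int.castRingHom (ZMod N)) A}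

/-- A (normalised) Hecke eigenfunction: a unit vector of `L²(ℤ/Nℤ)` that is an eigenvector of
`U_N(B)` for every `B` in the Hecke group (in particular of `U_N(A)`). -/
def IsHeckeEigenfunction (A : Matrix.SpecialLinearGroup (Fin 2) ℤ) (ψ : ZMod N → ℂ) : Prop :=
  stateInner N ψ ψ = 1 ∧ ∀ B ∈ heckeGroup N A, ∃ μ : ℂ, U N B *ᵥ ψ = μ • ψ

/-- The matrix element `⟨Op_N(f) ψ, ψ⟩`. -/
def matrixElement (f : Torus → ℝ) (ψ : ZMod N → ℂ) : ℂ :=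
  stateInner N (Op N f *ᵥ ψ) ψ

end CatMap

end

/-! Let N = p³, let a, b, c, d be the entries of A, and let v = (2c, d - a), the second row of A₀ =
2A - tr A. The subgroup L = {(p²s, pt)} of (ℤ/N)² is Lagrangian: the symplectic form vanishes on it
and it has order N. Hence the operators T(ℓ), ℓ ∈ L, commute and each of their joint eigencharacters
has a one-dimensional eigenspace. The characters are labelled by points u, and `coherentState u`
spans the eigenspace at u (`IsCoherent.eq_smul`).

Let φ be the state at v. A Hecke element B = 1 + pE preserves L. Modulo p, E is a traceless element
of the commutant of A, hence a multiple of A₀, and A₀² is the scalar (d - a)² + 4bc. So vE is a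
multiple of (0, 1) modulo p, and B moves v only along L, which leaves the eigencharacter unchanged.
Thus U(B)φ is a multiple of φ (`U_mulVec_coherentState`), and up to scalars the Hecke orbit of φ
depends only on B modulo p. This gives at most 2p lines (`card_centralizer_le`). They are pairwise
orthogonal, since U(B)φ has the label vB⁻¹ modulo p for the operators T(p²w), and v is a cyclic
vector for the commutant.

Averaging φ over the abelian Hecke group against a suitable character gives a nonzero Hecke
eigenfunction ψ: a combination, with coefficients of equal modulus, of at most 2p orthogonal vectors
of equal norm. In ⟨T(2v)ψ, ψ⟩ a pair B, C contributes only if B⁻¹ + 2 = C⁻¹ modulo p. As both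
determinants are 1, this forces B = -1 and C = 1. That single pair contributes ± one diagonal term,
because T(2v)U(-1) is an involution preserving the line of φ. So the normalised matrix element of
T(2v) has modulus at least 1/(2p), and the observable 2cos(2π 2v·x), of mean zero, gives at least
1/p = N^(-1/3). -/

noncomputable section

open scoped Matrix

namespace CatMap

/-! ### The commutant of a 2 × 2 matrix -/

section Algebra

/-- The entries of two commuting `2 × 2` matrices. -/
lemma commute_fin_two {R : Type*} [CommRing R] {A B : Matrix (Fin 2) (Fin 2) R}
    (h : A * B = B * A) :
    A 0 1 * B 1 0 = A 1 0 * B 0 1 ∧ A 0 1 * (B 1 1 - B 0 0) = B 0 1 * (A 1 1 - A 0 0) ∧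
      A 1 0 * (B 1 1 - B 0 0) = B 1 0 * (A 1 1 - A 0 0) := by
  have h00 := congrFun (congrFun h 0) 0
  have h01 := congrFun (congrFun h 0) 1
  have h10 := congrFun (congrFun h 1) 0
  simp only [Matrix.mul_apply, Fin.sum_univ_two] at h00 h01 h10
  refine ⟨?_, ?_, ?_⟩
  · linear_combination h00
  · linear_combination h01
  · linear_combination -h10

/-- Matrices commuting with a given `2 × 2` matrix with invertible lower left entry commute with
each other. -/
lemma commute_of_commute {R : Type*} [CommRing R] {A B C : Matrix (Fin 2) (Fin 2) R}
    (hc : IsUnit (A 1 0)) (hB : A * B = B * A) (hC : A * C = C * A) : B * C = C * B := by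
  obtain ⟨b1, b2, b3⟩ := commute_fin_two hB
  obtain ⟨c1, c2, c3⟩ := commute_fin_two hC
  -- Two matrices commute exactly when the vectors (upper right, lower left, difference of diagonal
  -- entries) are parallel. Those of B and C are both parallel to that of A, which has an invertible
  -- coordinate to cancel.
  have e1 : B 0 1 * C 1 0 = C 0 1 * B 1 0 := by
    apply hc.mul_left_cancel
    linear_combination - C 1 0 * b1 + B 1 0 * c1
  have e2 : B 0 1 * (C 1 1 - C 0 0) = C 0 1 * (B 1 1 - B 0 0) := by
    apply hc.mul_left_cancel
    linear_combination B 0 1 * c3 - C 0 1 * b3 + (A 1 1 - A 0 0) * e1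
  have e3 : B 1 0 * (C 1 1 - C 0 0) = C 1 0 * (B 1 1 - B 0 0) := by
    apply hc.mul_left_cancel
    linear_combination B 1 0 * c3 - C 1 0 * b3
  ext i j
  fin_cases i <;> fin_cases j <;> simp only [Matrix.mul_apply, Fin.sum_univ_two] <;> simp
  · linear_combination e1
  · linear_combination e2
  · linear_combination -e3
  · linear_combination -e1

variable {F : Type*} [Field F] {A : Matrix (Fin 2) (Fin 2) F}

/-- A matrix commuting with `A` that kills the row vector `(2c, d - a)` vanishes. -/
lemma eq_zero_of_vecMul_eq_zero (h2 : (2 : F) ≠ 0) (hc : A 1 0 ≠ 0)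
    (hdisc : (A 1 1 - A 0 0) ^ 2 + 4 * A 0 1 * A 1 0 ≠ 0) {E : Matrix (Fin 2) (Fin 2) F}
    (hE : A * E = E * A) (h0 : ![2 * A 1 0, A 1 1 - A 0 0] ᵥ* E = 0) : E = 0 := by
  obtain ⟨e1, e2, e3⟩ := commute_fin_two hE
  have k0 := congrFun h0 0
  have k1 := congrFun h0 1
  simp only [Matrix.vecMul, dotProduct, Fin.sum_univ_two, Matrix.cons_val_zero,
    Matrix.cons_val_one, Pi.zero_apply] at k0 k1
  -- Conceptually, E is a combination of 1 and A₀ = 2A - tr A, the row v is the second row of A₀,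
  -- and v and vA₀ = disc · (0, 1) are independent. In coordinates, the first entry of vE and the
  -- commutation relation add up to c · tr E = 0.
  have hw : E 1 1 = - E 0 0 := by
    apply mul_left_cancel₀ hc
    linear_combination k0 + e3
  rw [hw] at e2 e3 k1
  have hz : E 1 0 = 0 := by
    refine (mul_eq_zero.1 ?_).resolve_left hdisc
    linear_combination 2 * A 1 0 * k1 - (A 1 1 - A 0 0) * e3 + 4 * A 1 0 * e1
  rw [hz] at e1 e3
  have hx : E 0 0 = 0 := by
    refine (mul_eq_zero.1 ?_).resolve_left (mul_ne_zero h2 hc)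
    linear_combination -e3
  have hy : E 0 1 = 0 := by
    refine (mul_eq_zero.1 ?_).resolve_left hc
    linear_combination -e1
  ext i j
  fin_cases i <;> fin_cases j <;> simp [hx, hy, hz, hw]

/-- In the centralizer of a regular semisimple matrix, `det D = det (D + 2) = 1` forces
`D = -1`. -/
lemma eq_neg_one_of_det_add_two (h2 : (2 : F) ≠ 0)
    (hdisc : (A 1 1 - A 0 0) ^ 2 + 4 * A 0 1 * A 1 0 ≠ 0) {D : Matrix (Fin 2) (Fin 2) F}
    (hD : A * D = D * A) (h1 : D.det = 1) (h3 : (D + 2).det = 1) : D = -1 := by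
  obtain ⟨e1, e2, e3⟩ := commute_fin_two hD
  rw [Matrix.det_fin_two] at h1 h3
  have h20 : ((2 : Matrix (Fin 2) (Fin 2) F)) = Matrix.diagonal fun _ => 2 := rfl
  simp only [Matrix.add_apply, h20, Matrix.diagonal_apply] at h3
  norm_num at h3
  -- Since det (D + 2) = det D + 2 tr D + 4, the trace is -2, so (D + 1)² = 0. The nonzero
  -- discriminant leaves no nonzero nilpotents in the commutant: the squares of the off-diagonal
  -- entries are killed by it.
  have hw : D 1 1 = -2 - D 0 0 := by
    have : 2 * (D 1 1 - (-2 - D 0 0)) = 0 := by linear_combination h3 - h1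
    exact sub_eq_zero.1 ((mul_eq_zero.1 this).resolve_left h2)
  rw [hw] at e2 e3 h1
  have hy : D 0 1 = 0 := by
    have : D 0 1 ^ 2 = 0 := by
      refine (mul_eq_zero.1 ?_).resolve_left hdisc
      linear_combination -(D 0 1 * (A 1 1 - A 0 0) + A 0 1 * (-2 - D 0 0 - D 0 0)) * e2
        - 4 * A 0 1 * D 0 1 * e1 - 4 * A 0 1 ^ 2 * h1
    exact pow_eq_zero_iff (two_ne_zero) |>.1 this
  have hz : D 1 0 = 0 := by
    have : D 1 0 ^ 2 = 0 := by
      refine (mul_eq_zero.1 ?_).resolve_left hdisc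
      linear_combination -(D 1 0 * (A 1 1 - A 0 0) + A 1 0 * (-2 - D 0 0 - D 0 0)) * e3
        + 4 * A 1 0 * D 1 0 * e1 - 4 * A 1 0 ^ 2 * h1
    exact pow_eq_zero_iff (two_ne_zero) |>.1 this
  have hx : D 0 0 = -1 := by
    have : (D 0 0 + 1) ^ 2 = 0 := by
      rw [hy, hz] at h1
      linear_combination -h1
    exact eq_neg_of_add_eq_zero_left (pow_eq_zero_iff (two_ne_zero) |>.1 this)
  have hw' : D 1 1 = -1 := by rw [hw, hx]; ring
  ext i j
  fin_cases i <;> fin_cases j <;> simp [hx, hy, hz, hw']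

/-- The centralizer in `SL(2, F)` of a matrix with nonzero lower left entry has at most `2 |F|`
elements. -/
lemma card_centralizer_le [Fintype F] [DecidableEq F] (hc : A 1 0 ≠ 0)
    (S : Finset (Matrix.SpecialLinearGroup (Fin 2) F)) (hS : ∀ B ∈ S, A * B.1 = B.1 * A) :
    S.card ≤ 2 * Fintype.card F := by
  have key : ∀ B ∈ S, ∀ C ∈ S, B.1 1 0 = C.1 1 0 → B.1 0 0 = C.1 0 0 → B = C := by
    intro B hB C hC hz hx
    obtain ⟨b1, b2, b3⟩ := commute_fin_two (hS B hB)
    obtain ⟨c1, c2, c3⟩ := commute_fin_two (hS C hC)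
    have hy : B.1 0 1 = C.1 0 1 := by
      apply mul_left_cancel₀ hc
      rw [← b1, ← c1, hz]
    have hw : B.1 1 1 = C.1 1 1 := by
      apply mul_left_cancel₀ hc
      linear_combination b3 - c3 + A 1 0 * hx + (A 1 1 - A 0 0) * hz
    apply Subtype.ext
    ext i j
    fin_cases i <;> fin_cases j <;> assumption
  refine (Finset.card_le_mul_card_image_of_maps_to (f := fun B => B.1 1 0) (t := Finset.univ)
    (fun _ _ => Finset.mem_univ _) 2 fun z _ => ?_)
  -- Once the lower left entry z is fixed, commutation expresses the other entries through the upper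
  -- left one, and det = 1 becomes this monic quadratic in it: two roots for each of the |F| values
  -- of z.
  open Polynomial in
  let P : F[X] := X ^ 2 + C (z * (A 1 1 - A 0 0) / A 1 0) * X + C (-(A 0 1 * z ^ 2 / A 1 0) - 1)
  have hP : P.natDegree = 2 := by
    simp only [P]
    compute_degree!
  have hP0 : P ≠ 0 := by
    intro h
    rw [h] at hP
    simp at hP
  calc _ ≤ P.roots.toFinset.card := by
        refine Finset.card_le_card_of_injOn (fun B => B.1 0 0) ?_ ?_
        · intro B hB
          obtain ⟨hB, hz⟩ := Finset.mem_filter.1 hB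
          obtain ⟨b1, b2, b3⟩ := commute_fin_two (hS B hB)
          have hd := B.2
          rw [Matrix.det_fin_two] at hd
          simp only [Finset.mem_coe, Multiset.mem_toFinset, Polynomial.mem_roots hP0,
            Polynomial.IsRoot.def, P, Polynomial.eval_add, Polynomial.eval_mul,
            Polynomial.eval_pow, Polynomial.eval_X, Polynomial.eval_C]
          rw [← hz]
          field_simp
          linear_combination A 1 0 * hd - B.1 0 0 * b3 - B.1 1 0 * b1
        · intro B hB C hC h
          obtain ⟨hB, hz⟩ := Finset.mem_filter.1 hB
          obtain ⟨hC, hz'⟩ := Finset.mem_filter.1 hC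
          exact key B hB C hC (hz.trans hz'.symm) h
    _ ≤ P.natDegree := (Multiset.toFinset_card_le _).trans (Polynomial.card_roots' _)
    _ = 2 := hP

end Algebra

/-! ### Trigonometric observables and their quantization -/

section Observable

open MeasureTheory UnitAddTorus

lemma fourier_coe_one (n : ℤ) (x : ℝ) :
    fourier n (x : UnitAddCircle) = Complex.exp (2 * Real.pi * Complex.I * n * x) := by
  simp

/-- The integral of a monomial over the torus: it vanishes unless the monomial is trivial. -/
lemma integral_mFourier (n : Fin 2 → ℤ) :
    ∫ t, mFourier n t ∂(Measure.pi fun _ : Fin 2 => AddCircle.haarAddCircle (T := (1 : ℝ))) =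
      if n = 0 then 1 else 0 := by
  simp only [mFourier, ContinuousMap.coe_mk]
  rw [integral_fintype_prod_eq_prod (𝕜 := ℂ) (f := fun i (x : UnitAddCircle) => fourier (n i) x)]
  have h : ∀ k : ℤ, ∫ x, fourier k x ∂(AddCircle.haarAddCircle (T := (1 : ℝ))) =
      if k = 0 then (1 : ℂ) else 0 := by
    intro k
    -- The integral of a character is its inner product with the constant character.
    have := (orthonormal_iff_ite.1 (orthonormal_fourier (T := 1))) 0 k
    rw [ContinuousMap.inner_toLp] at this
    simpa [eq_comm] using this
  simp only [h, Finset.prod_ite_zero, Finset.prod_const_one, Finset.mem_univ, true_implies]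
  congr 1
  exact propext ⟨fun h => funext h, fun h i => by rw [h]; rfl⟩

/-- The real observable `2 cos(2π n·x)` on the torus. -/
def cosObservable (n : Fin 2 → ℤ) (t : Torus) : ℝ := 2 * (mFourier n t).re

lemma cosObservable_eq (n : Fin 2 → ℤ) (t : Torus) :
    (cosObservable n t : ℂ) = mFourier n t + mFourier (-n) t := by
  rw [mFourier_neg, Complex.add_conj, cosObservable]

lemma isSmooth_cosObservable (n : Fin 2 → ℤ) : IsSmooth (cosObservable n) := by
  unfold IsSmooth cosObservable
  simp only [mFourier, ContinuousMap.coe_mk, fourier_coe_one]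
  have h : ContDiff ℝ (⊤ : ℕ∞) fun x : Fin 2 → ℝ =>
      ∏ i, Complex.exp (2 * Real.pi * Complex.I * n i * x i) :=
    contDiff_prod fun i _ => ContDiff.cexp (contDiff_const.mul
      (Complex.ofRealCLM.contDiff.comp (contDiff_apply ℝ ℝ i)))
  exact contDiff_const.mul (Complex.reCLM.contDiff.comp h)

lemma integrable_mFourier (n : Fin 2 → ℤ) :
    Integrable (fun t => mFourier n t)
      (Measure.pi fun _ : Fin 2 => AddCircle.haarAddCircle (T := (1 : ℝ))) :=
  (mFourier n).continuous.integrable_of_hasCompactSupport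
    (HasCompactSupport.of_compactSpace _)

lemma average_cosObservable {n : Fin 2 → ℤ} (hn : n ≠ 0) : average (cosObservable n) = 0 := by
  have h : (average (cosObservable n) : ℂ) = 0 := by
    rw [average]
    refine integral_ofReal.symm.trans ?_
    refine (integral_congr_ae (.of_forall (cosObservable_eq n))).trans ?_
    rw [integral_add (integrable_mFourier n) (integrable_mFourier (-n)), integral_mFourier,
      integral_mFourier, if_neg hn, if_neg (neg_ne_zero.2 hn), add_zero]
  exact_mod_cast h

lemma mFourierCoeff_cosObservable (n k : Fin 2 → ℤ) :
    mFourierCoeff (fun x => (cosObservable n x : ℂ)) k =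
      (if k = n then 1 else 0) + if k = -n then 1 else 0 := by
  change ∫ t, mFourier (-k) t • (cosObservable n t : ℂ)
    ∂(Measure.pi fun _ : Fin 2 => AddCircle.haarAddCircle (T := (1 : ℝ))) = _
  simp only [cosObservable_eq, smul_eq_mul, mul_add, ← mFourier_add]
  rw [integral_add (integrable_mFourier _) (integrable_mFourier _), integral_mFourier,
    integral_mFourier]
  congr 2
  · exact propext ⟨fun h => (neg_add_eq_zero.1 h), fun h => (neg_add_eq_zero.2 h)⟩
  · exact propext ⟨fun h => (neg_add_eq_zero.1 h), fun h => (neg_add_eq_zero.2 h)⟩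

lemma Op_cosObservable (N : ℕ) [NeZero N] (n : Fin 2 → ℤ) :
    Op N (cosObservable n) = elemOp N n + elemOp N (-n) := by
  simp only [Op, mFourierCoeff_cosObservable, add_smul, ite_smul, one_smul, zero_smul]
  rw [Summable.tsum_add, tsum_ite_eq, tsum_ite_eq]
  all_goals exact summable_of_hasFiniteSupport ((Set.finite_singleton _).subset fun k hk => by
    by_contra h
    exact hk (if_neg h))

end Observable

/-! ### Commutation relations and orthogonality of eigenvectors -/

section CoherentStates

open Matrix

variable {N : ℕ} [NeZero N]

lemma twOp_mul_U (hN : Odd N) (B : SpecialLinearGroup (Fin 2) (ZMod N)) (n : Fin 2 → ZMod N) :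
    twOp N n * U N B = U N B * twOp N (n ᵥ* B.1) := by
  rw [U, Matrix.mul_smul, Matrix.smul_mul, twOp_mul_rawU N hN]

/-- The two orders of multiplication carry opposite half-phases, so their quotient is the full
symplectic phase. Isotropic subgroups therefore act by commuting operators. -/
lemma twOp_comm (hN : Odd N) (m n : Fin 2 → ZMod N) :
    twOp N m * twOp N n =
      (ZMod.stdAddChar (m 0 * n 1 - m 1 * n 0) : ℂ) • (twOp N n * twOp N m) := by
  rw [twOp_mul N hN, twOp_mul N hN, smul_smul, ← AddChar.map_add_eq_mul, add_comm m n]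
  congr 2
  linear_combination (m 0 * n 1 - m 1 * n 0) * two_inv_mul N hN

lemma twOp_neg_mul_self (hN : Odd N) (n : Fin 2 → ZMod N) : twOp N (-n) * twOp N n = 1 := by
  rw [twOp_mul N hN, neg_add_cancel, twOp_zero]
  have : (-n) 0 * n 1 - (-n) 1 * n 0 = 0 := by simp only [Pi.neg_apply]; ring
  rw [this, mul_zero, AddChar.map_zero_eq_one, one_smul]

lemma mulVec_dotProduct_star (V : Matrix (ZMod N) (ZMod N) ℂ) (φ ψ : ZMod N → ℂ) :
    (V *ᵥ φ) ⬝ᵥ star ψ = φ ⬝ᵥ star (Vᴴ *ᵥ ψ) := by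
  rw [star_mulVec, conjTranspose_conjTranspose, dotProduct_comm, dotProduct_mulVec,
    dotProduct_comm]

lemma mulVec_dotProduct_star_mulVec {V : Matrix (ZMod N) (ZMod N) ℂ} (hV : Vᴴ * V = 1)
    (φ ψ : ZMod N → ℂ) : (V *ᵥ φ) ⬝ᵥ star (V *ᵥ ψ) = φ ⬝ᵥ star ψ := by
  rw [mulVec_dotProduct_star, mulVec_mulVec, hV, one_mulVec]

/-- Eigenvectors of a twisted elementary operator with distinct eigenvalues are orthogonal. -/
lemma eq_of_dotProduct_ne_zero (hN : Odd N) {m : Fin 2 → ZMod N} {φ ψ : ZMod N → ℂ}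
    {x y : ZMod N} (hφ : twOp N m *ᵥ φ = (ZMod.stdAddChar x : ℂ) • φ)
    (hψ : twOp N m *ᵥ ψ = (ZMod.stdAddChar y : ℂ) • ψ) (h : φ ⬝ᵥ star ψ ≠ 0) : x = y := by
  have h1 := mulVec_dotProduct_star_mulVec (V := twOp N m)
    (by rw [twOp_star N hN, twOp_neg_mul_self hN]) φ ψ
  rw [hφ, hψ, star_smul, star_stdAddChar, smul_dotProduct, dotProduct_smul, smul_smul,
    ← AddChar.map_add_eq_mul, smul_eq_mul] at h1
  have h2 : (ZMod.stdAddChar (x + -y) : ℂ) = ZMod.stdAddChar (0 : ZMod N) := by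
    rw [AddChar.map_zero_eq_one]
    exact mul_right_cancel₀ h (by rw [h1, one_mul])
  have := ZMod.injective_stdAddChar h2
  rwa [← sub_eq_add_neg, sub_eq_zero] at this

end CoherentStates

/-! ### Coherent states for the Lagrangian subgroup {(p²s, pt)} modulo p³ -/

section PrimeCube

open Matrix

variable (p : ℕ) [Fact p.Prime]

/-- Reduction modulo `p`. -/
def red : ZMod (p ^ 3) →+* ZMod p := ZMod.castHom (dvd_pow_self p three_ne_zero) (ZMod p)

variable {p}

lemma p_cube {p : ℕ} : (p : ZMod (p ^ 3)) ^ 3 = 0 := by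
  rw [← Nat.cast_pow, ZMod.natCast_self]

lemma exists_of_mul_eq_zero {j k : ℕ} (hjk : j + k = 3) {x : ZMod (p ^ 3)}
    (h : (p : ZMod (p ^ 3)) ^ j * x = 0) : ∃ y, x = (p : ZMod (p ^ 3)) ^ k * y := by
  obtain ⟨n, rfl⟩ := ZMod.natCast_zmod_surjective x
  have hp : p ≠ 0 := (Fact.out : p.Prime).ne_zero
  have h' : ((p ^ j * n : ℕ) : ZMod (p ^ 3)) = 0 := by push_cast; exact h
  rw [ZMod.natCast_eq_zero_iff, ← hjk, pow_add,
    Nat.mul_dvd_mul_iff_left (pow_pos (Nat.pos_of_ne_zero hp) j)] at h'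
  obtain ⟨m, rfl⟩ := h'
  exact ⟨m, by push_cast; rfl⟩

lemma red_eq_zero_iff {x : ZMod (p ^ 3)} : red p x = 0 ↔ (p : ZMod (p ^ 3)) ^ 2 * x = 0 := by
  obtain ⟨n, rfl⟩ := ZMod.natCast_zmod_surjective x
  have hp : p ≠ 0 := (Fact.out : p.Prime).ne_zero
  have h' : (p : ZMod (p ^ 3)) ^ 2 * n = ((p ^ 2 * n : ℕ) : ZMod (p ^ 3)) := by push_cast; rfl
  rw [h', ZMod.natCast_eq_zero_iff, map_natCast, ZMod.natCast_eq_zero_iff, pow_succ p 2,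
    Nat.mul_dvd_mul_iff_left (pow_pos (Nat.pos_of_ne_zero hp) 2)]

/-- `φ` is a joint eigenvector of the `T(p²s, pt)`, with the eigencharacter belonging to `u`. -/
def IsCoherent (u : Fin 2 → ZMod (p ^ 3)) (φ : ZMod (p ^ 3) → ℂ) : Prop :=
  ∀ s t : ZMod (p ^ 3), twOp (p ^ 3) ![(p : ZMod (p ^ 3)) ^ 2 * s, (p : ZMod (p ^ 3)) * t] *ᵥ φ =
    (ZMod.stdAddChar ((p : ZMod (p ^ 3)) ^ 2 * s * u 1 - (p : ZMod (p ^ 3)) * t * u 0) : ℂ) • φ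

variable (p) in
/-- The indicator function of the multiples of `p²`. -/
def baseState (y : ZMod (p ^ 3)) : ℂ := if (p : ZMod (p ^ 3)) * y = 0 then 1 else 0

/-- The translate of `baseState` by `u`. -/
def coherentState (u : Fin 2 → ZMod (p ^ 3)) : ZMod (p ^ 3) → ℂ :=
  twOp (p ^ 3) u *ᵥ baseState p

lemma twOp_mulVec (N : ℕ) [NeZero N] (n : Fin 2 → ZMod N) (φ : ZMod N → ℂ) (y : ZMod N) :
    (twOp N n *ᵥ φ) y =
      ZMod.stdAddChar ((2 : ZMod N)⁻¹ * (n 0 * n 1) + n 1 * y) * φ (y + n 0) := by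
  simp [twOp, Matrix.mulVec, dotProduct]

/-- Shifts by p² preserve the support, modulations by multiples of p are trivial on it, and the
phase from the product of both coordinates dies because p³ = 0. -/
lemma isCoherent_baseState : IsCoherent 0 (baseState p) := by
  intro s t
  ext y
  have h0 : (p : ZMod (p ^ 3)) ^ 2 * s * (p * t) = 0 := by linear_combination (s * t) * p_cube (p := p)
  have h1 : (p : ZMod (p ^ 3)) * (y + p ^ 2 * s) = p * y := by
    linear_combination s * p_cube (p := p)
  rw [twOp_mulVec]
  simp only [cons_val_zero, cons_val_one, h0, baseState, h1, Pi.zero_apply, mul_zero, sub_zero,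
    AddChar.map_zero_eq_one, one_smul, zero_add]
  split_ifs with h
  · rw [mul_right_comm, h, zero_mul, AddChar.map_zero_eq_one, mul_one]
  · rw [mul_zero]

/-- Moving T(p²s, pt) past T(v) costs the symplectic pairing with v, which is exactly a shift of the
label by v. -/
lemma IsCoherent.twOp_mulVec (hp : Odd (p ^ 3)) {u : Fin 2 → ZMod (p ^ 3)}
    {φ : ZMod (p ^ 3) → ℂ} (h : IsCoherent u φ) (v : Fin 2 → ZMod (p ^ 3)) :
    IsCoherent (u + v) (twOp (p ^ 3) v *ᵥ φ) := by
  intro s t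
  rw [mulVec_mulVec, twOp_comm hp, smul_mulVec, ← mulVec_mulVec, h s t, mulVec_smul, smul_smul,
    ← AddChar.map_add_eq_mul]
  congr 2
  simp only [cons_val_zero, cons_val_one, Pi.add_apply]
  ring_nf

lemma isCoherent_coherentState (hp : Odd (p ^ 3)) (u : Fin 2 → ZMod (p ^ 3)) :
    IsCoherent u (coherentState u) := by
  have := isCoherent_baseState.twOp_mulVec (p := p) hp u
  rwa [zero_add] at this

/-- Multiplicity one for a Lagrangian subgroup: translating back to the label 0 leaves a function
invariant under shifts by p² and under modulations by p. Every proportionality between coherent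
states below comes from here. -/
lemma IsCoherent.eq_smul (hp : Odd (p ^ 3)) {u : Fin 2 → ZMod (p ^ 3)}
    {φ : ZMod (p ^ 3) → ℂ} (h : IsCoherent u φ) : ∃ κ : ℂ, φ = κ • coherentState u := by
  have h' := h.twOp_mulVec hp (-u)
  rw [add_neg_cancel] at h'
  set φ' := twOp (p ^ 3) (-u) *ᵥ φ with hφ'
  have hφ : φ = twOp (p ^ 3) u *ᵥ φ' := by
    have := twOp_neg_mul_self hp (-u)
    rw [neg_neg] at this
    rw [hφ', mulVec_mulVec, this, one_mulVec]
  refine ⟨φ' 0, ?_⟩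
  rw [hφ, coherentState, ← mulVec_smul]
  congr 1
  ext y
  rw [Pi.smul_apply, smul_eq_mul, baseState]
  split_ifs with hy
  -- On multiples of p², shift invariance makes the function constant.
  · obtain ⟨s, rfl⟩ := exists_of_mul_eq_zero (j := 1) (k := 2) rfl (by rwa [pow_one])
    have := congrFun (h' s 0) 0
    rw [CatMap.twOp_mulVec] at this
    simpa using this
  -- Off them, modulation by p multiplies the value by a phase different from 1, so the value is
  -- zero.
  · have := congrFun (h' 0 1) y
    rw [CatMap.twOp_mulVec] at this
    simp only [cons_val_zero, cons_val_one, mul_zero, zero_mul, mul_one, add_zero, zero_add,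
      Pi.zero_apply, sub_zero, AddChar.map_zero_eq_one, one_smul] at this
    by_contra h0
    rw [mul_zero] at h0
    have h1 : (ZMod.stdAddChar ((p : ZMod (p ^ 3)) * y) : ℂ) = ZMod.stdAddChar (0 : ZMod (p ^ 3)) := by
      rw [AddChar.map_zero_eq_one]
      exact mul_right_cancel₀ h0 (by rw [this, one_mul])
    exact hy (ZMod.injective_stdAddChar h1)

lemma coherentState_ne_zero (hp : Odd (p ^ 3)) (u : Fin 2 → ZMod (p ^ 3)) :
    coherentState u ≠ 0 := by
  intro h
  have h1 : baseState p = 0 := by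
    rw [← one_mulVec (baseState p), ← twOp_neg_mul_self hp u, ← mulVec_mulVec]
    rw [coherentState] at h
    rw [h, mulVec_zero]
  have := congrFun h1 0
  simp [baseState] at this

/-- Coherent states are moved by the propagators like points of the torus modulo `p`. -/
lemma IsCoherent.twOp_U_mulVec (hp : Odd (p ^ 3)) {u : Fin 2 → ZMod (p ^ 3)}
    {φ : ZMod (p ^ 3) → ℂ} (h : IsCoherent u φ) (B : SpecialLinearGroup (Fin 2) (ZMod (p ^ 3)))
    (w : Fin 2 → ZMod (p ^ 3)) :
    twOp (p ^ 3) ((p : ZMod (p ^ 3)) ^ 2 • w) *ᵥ (U (p ^ 3) B *ᵥ φ) =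
      (ZMod.stdAddChar ((p : ZMod (p ^ 3)) ^ 2 * (w 0 * (u ᵥ* (B⁻¹).1) 1 -
        w 1 * (u ᵥ* (B⁻¹).1) 0)) : ℂ) • (U (p ^ 3) B *ᵥ φ) := by
  rw [mulVec_mulVec, twOp_mul_U hp, ← mulVec_mulVec]
  have hB : (B⁻¹).1 * B.1 = 1 := congrArg Subtype.val (inv_mul_cancel B)
  -- A general B does not preserve L, but it preserves p²(ℤ/N)², which lies in L. Restricting to
  -- this subgroup keeps the label modulo p.
  have h1 : ((p : ZMod (p ^ 3)) ^ 2 • w) ᵥ* B.1 =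
      ![(p : ZMod (p ^ 3)) ^ 2 * (w ᵥ* B.1) 0, p * (p * (w ᵥ* B.1) 1)] := by
    rw [smul_vecMul]
    ext i
    fin_cases i
    · simp
    · simp; ring
  have h2 := symplectic (p ^ 3) B w (u ᵥ* (B⁻¹).1)
  rw [vecMul_vecMul, hB, vecMul_one] at h2
  rw [h1, h _ _, mulVec_smul, ← h2]
  congr 2
  ring_nf

/-- Matrix elements between moved coherent states vanish unless the points match modulo `p`. -/
lemma red_eq_of_dotProduct_ne_zero (hp : Odd (p ^ 3)) {u v : Fin 2 → ZMod (p ^ 3)}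
    {φ : ZMod (p ^ 3) → ℂ} (h : IsCoherent u φ)
    {B C : SpecialLinearGroup (Fin 2) (ZMod (p ^ 3))}
    (h0 : (twOp (p ^ 3) v *ᵥ (U (p ^ 3) B *ᵥ φ)) ⬝ᵥ star (U (p ^ 3) C *ᵥ φ) ≠ 0) (i : Fin 2) :
    red p ((v + u ᵥ* (B⁻¹).1 - u ᵥ* (C⁻¹).1) i) = 0 := by
  have key : ∀ w : Fin 2 → ZMod (p ^ 3), (p : ZMod (p ^ 3)) ^ 2 * (w 0 *
      (v + u ᵥ* (B⁻¹).1 - u ᵥ* (C⁻¹).1) 1 - w 1 * (v + u ᵥ* (B⁻¹).1 - u ᵥ* (C⁻¹).1) 0) = 0 := by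
    intro w
    have hB : twOp (p ^ 3) ((p : ZMod (p ^ 3)) ^ 2 • w) *ᵥ
        (twOp (p ^ 3) v *ᵥ (U (p ^ 3) B *ᵥ φ)) = (ZMod.stdAddChar ((p : ZMod (p ^ 3)) ^ 2 *
          (w 0 * (v + u ᵥ* (B⁻¹).1) 1 - w 1 * (v + u ᵥ* (B⁻¹).1) 0)) : ℂ) •
        (twOp (p ^ 3) v *ᵥ (U (p ^ 3) B *ᵥ φ)) := by
      rw [mulVec_mulVec, twOp_comm hp, smul_mulVec, ← mulVec_mulVec, h.twOp_U_mulVec hp B w,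
        mulVec_smul, smul_smul, ← AddChar.map_add_eq_mul]
      congr 2
      simp only [Pi.smul_apply, smul_eq_mul, Pi.add_apply]
      ring_nf
    have := eq_of_dotProduct_ne_zero hp hB (h.twOp_U_mulVec hp C w) h0
    simp only [Pi.add_apply, Pi.sub_apply] at this ⊢
    linear_combination this
  rw [red_eq_zero_iff]
  fin_cases i
  · simpa using key ![0, -1]
  · simpa using key ![1, 0]

end PrimeCube

/-! ### Averaging over a finite group against a character -/

section Averages

variable {G H : Type*} [Group G] [Fintype G] [Group H] [DecidableEq H]

/-- A vector-valued function on a finite abelian group that does not vanish at `1` has a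
nonvanishing Fourier coefficient. -/
lemma exists_monoidHom_sum_ne_zero (hG : ∀ g h : G, g * h = h * g) {V : Type*} [AddCommGroup V]
    [Module ℂ V] (θ : G → V) (h : θ 1 ≠ 0) : ∃ χ : G →* ℂ, ∑ g, χ g⁻¹ • θ g ≠ 0 := by
  classical
  let _ : CommGroup G := { (inferInstance : Group G) with mul_comm := hG }
  -- By orthogonality of characters the Fourier coefficients sum to |G| θ(1), so they cannot all
  -- vanish.
  have key : ∑ χ : AddChar (Additive G) ℂ, ∑ g : G, χ (Additive.ofMul g⁻¹) • θ g ≠ 0 := by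
    rw [Finset.sum_comm]
    simp_rw [← Finset.sum_smul, AddChar.sum_apply_eq_ite]
    rw [Finset.sum_eq_single 1]
    · simp only [inv_one, ofMul_one, if_true]
      exact smul_ne_zero (Nat.cast_ne_zero.2 Fintype.card_ne_zero) h
    · intro g _ hg
      rw [if_neg, zero_smul]
      rwa [ofMul_eq_zero, inv_eq_one]
    · simp
  obtain ⟨χ, -, hχ⟩ := Finset.exists_ne_zero_of_sum_ne_zero key
  exact ⟨{ toFun := fun g => χ (Additive.ofMul g),
            map_one' := by rw [ofMul_one, AddChar.map_zero_eq_one],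
            map_mul' := fun g h => by rw [ofMul_mul, AddChar.map_add_eq_mul] }, hχ⟩

lemma norm_monoidHom_apply (χ : G →* ℂ) (g : G) : ‖χ g‖ = 1 := by
  refine (pow_eq_one_iff_of_nonneg (norm_nonneg _) (Fintype.card_ne_zero (α := G))).1 ?_
  rw [← norm_pow, ← map_pow, pow_card_eq_one, map_one, norm_one]

lemma card_fiber (r : G →* H) (g : G) :
    (Finset.univ.filter fun g' => r g' = r g).card =
      (Finset.univ.filter fun g' => r g' = 1).card :=
  MonoidHom.card_fiber_eq_of_mem_range r ⟨g, rfl⟩ ⟨1, map_one r⟩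

lemma card_le_mul_card_fiber (r : G →* H) :
    Fintype.card G ≤ (Finset.univ.image r).card * (Finset.univ.filter fun g => r g = 1).card := by
  rw [← Finset.card_univ, mul_comm]
  refine Finset.card_le_mul_card_image _ _ fun h hh => ?_
  obtain ⟨g, -, rfl⟩ := Finset.mem_image.1 hh
  exact (card_fiber r g).le

variable {ι : Type*} [Fintype ι]

/-- The norm of a sum of vectors indexed by a group, when vectors in the same fiber of a
homomorphism agree and vectors in different fibers are orthogonal. -/
lemma sum_dotProduct_star_sum (r : G →* H) (θ : G → ι → ℂ) (hθ : ∀ g h, r g = r h → θ g = θ h)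
    (horth : ∀ g h, θ g ⬝ᵥ star (θ h) ≠ 0 → r g = r h) {s : ℂ}
    (hs : ∀ g, θ g ⬝ᵥ star (θ g) = s) :
    (∑ g, θ g) ⬝ᵥ star (∑ g, θ g) =
      Fintype.card G * (Finset.univ.filter fun g => r g = 1).card * s := by
  rw [star_sum, sum_dotProduct]
  have h : ∀ g, θ g ⬝ᵥ ∑ h, star (θ h) = (Finset.univ.filter fun g => r g = 1).card * s := by
    intro g
    rw [dotProduct_sum, ← card_fiber r g, ← nsmul_eq_mul, ← Finset.sum_const, Finset.sum_filter]
    refine Finset.sum_congr rfl fun h _ => ?_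
    split_ifs with hr
    · rw [hθ h g hr, hs]
    · by_contra h0
      exact hr (horth g h h0).symm
  simp only [h, Finset.sum_const, Finset.card_univ, nsmul_eq_mul, mul_assoc]

/-- A matrix element of a sum of vectors indexed by a group, when only one pair of fibers of a
homomorphism contributes. -/
lemma mulVec_sum_dotProduct_star_sum (r : G →* H) (θ : G → ι → ℂ)
    (hθ : ∀ g h, r g = r h → θ g = θ h) (W : Matrix ι ι ℂ) (a : G)
    (hW : ∀ g h, (W *ᵥ θ g) ⬝ᵥ star (θ h) ≠ 0 → r g = r a ∧ r h = 1) :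
    (W *ᵥ ∑ g, θ g) ⬝ᵥ star (∑ g, θ g) =
      (Finset.univ.filter fun g => r g = 1).card ^ 2 * ((W *ᵥ θ a) ⬝ᵥ star (θ 1)) := by
  have h1 : ∀ g h, (W *ᵥ θ g) ⬝ᵥ star (θ h) =
      if r g = r a then if r h = 1 then (W *ᵥ θ a) ⬝ᵥ star (θ 1) else 0 else 0 := by
    intro g h
    split_ifs with hg hh
    · rw [hθ g a hg, hθ h 1 (hh.trans (map_one r).symm)]
    · by_contra h0
      exact hh (hW g h h0).2
    · by_contra h0
      exact hg (hW g h h0).1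
  rw [Matrix.mulVec_sum, star_sum, sum_dotProduct]
  have h2 : ∀ g, (W *ᵥ θ g) ⬝ᵥ ∑ h, star (θ h) = if r g = r a then
      (Finset.univ.filter fun g => r g = 1).card * ((W *ᵥ θ a) ⬝ᵥ star (θ 1)) else 0 := by
    intro g
    rw [dotProduct_sum, Finset.sum_congr rfl fun h _ => h1 g h]
    split_ifs
    · rw [← Finset.sum_filter, Finset.sum_const, nsmul_eq_mul]
    · rw [Finset.sum_const_zero]
  rw [Finset.sum_congr rfl fun g _ => h2 g, ← Finset.sum_filter, Finset.sum_const, card_fiber r a,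
    nsmul_eq_mul]
  ring

end Averages

/-! ### The Hecke group and its congruence subgroup modulo p -/

section HeckeGroup

open Matrix

/-- The matrix `-1` in `SL(2, R)`. -/
def negOne (R : Type*) [CommRing R] : SpecialLinearGroup (Fin 2) R :=
  ⟨-1, by simp [det_fin_two]⟩

variable (p : ℕ) [Fact p.Prime]

/-- Reduction modulo `p` on `SL(2)`. -/
def redSL : SpecialLinearGroup (Fin 2) (ZMod (p ^ 3)) →* SpecialLinearGroup (Fin 2) (ZMod p) :=
  SpecialLinearGroup.map (red p)

variable {p}

lemma redSL_apply (B : SpecialLinearGroup (Fin 2) (ZMod (p ^ 3))) (i j : Fin 2) :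
    (redSL p B).1 i j = red p (B.1 i j) := rfl

lemma redSL_negOne : redSL p (negOne _) = negOne _ := by
  apply Subtype.ext
  ext i j
  rw [redSL_apply]
  fin_cases i <;> fin_cases j <;> simp [negOne]

/-- The fixed row vector `(2c, d - a)` attached to `A`. -/
def heckeVector (A : SpecialLinearGroup (Fin 2) ℤ) : Fin 2 → ℤ := ![2 * A.1 1 0, A.1 1 1 - A.1 0 0]

variable (p) in
/-- The reduction of `heckeVector` modulo `p³`. -/
def heckePoint (A : SpecialLinearGroup (Fin 2) ℤ) : Fin 2 → ZMod (p ^ 3) :=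
  fun i => (heckeVector A i : ZMod (p ^ 3))

variable {A : SpecialLinearGroup (Fin 2) ℤ}

lemma mem_heckeGroup {N : ℕ} [NeZero N] {B : SpecialLinearGroup (Fin 2) (ZMod N)}
    (hB : B ∈ heckeGroup N A) :
    A.1.map (Int.cast : ℤ → ZMod N) * B.1 = B.1 * A.1.map (Int.cast : ℤ → ZMod N) :=
  congrArg Subtype.val (Subgroup.mem_centralizer_iff.1 hB _ rfl)

lemma commute_redSL {B : SpecialLinearGroup (Fin 2) (ZMod (p ^ 3))}
    (hB : B ∈ heckeGroup (p ^ 3) A) :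
    A.1.map (Int.cast : ℤ → ZMod p) * (redSL p B).1 =
      (redSL p B).1 * A.1.map (Int.cast : ℤ → ZMod p) := by
  have h := congrArg (fun M => M.map (red p)) (mem_heckeGroup hB)
  simp only [Matrix.map_mul] at h
  have hA : (A.1.map (Int.cast : ℤ → ZMod (p ^ 3))).map (red p) =
      A.1.map (Int.cast : ℤ → ZMod p) := by
    ext i j
    simp
  rw [hA] at h
  exact h

lemma negOne_mem_heckeGroup (N : ℕ) [NeZero N] : negOne (ZMod N) ∈ heckeGroup N A := by
  rw [heckeGroup, Subgroup.mem_centralizer_iff]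
  rintro _ rfl
  apply Subtype.ext
  change _ * (-1 : Matrix (Fin 2) (Fin 2) (ZMod N)) = (-1) * _
  rw [mul_neg, neg_mul, mul_one, one_mul]

lemma isUnit_intCast_of_ne_zero {c : ℤ} (hc : (c : ZMod p) ≠ 0) : IsUnit (c : ZMod (p ^ 3)) := by
  rw [ZMod.coe_int_isUnit_iff_isCoprime]
  have h := (ZMod.coe_int_isUnit_iff_isCoprime c p).1 (isUnit_iff_ne_zero.2 hc)
  push_cast
  exact h.pow_left

lemma heckeGroup_comm (hc : (A.1 1 0 : ZMod p) ≠ 0)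
    {B C : SpecialLinearGroup (Fin 2) (ZMod (p ^ 3))}
    (hB : B ∈ heckeGroup (p ^ 3) A) (hC : C ∈ heckeGroup (p ^ 3) A) : B * C = C * B :=
  Subtype.ext (commute_of_commute (isUnit_intCast_of_ne_zero hc)
    (mem_heckeGroup hB) (mem_heckeGroup hC))

/-- The elements of the Hecke group that are trivial modulo `p` fix the coherent state at
`heckePoint` up to scalars. -/
lemma U_mulVec_coherentState (hp : Odd (p ^ 3)) {B : SpecialLinearGroup (Fin 2) (ZMod (p ^ 3))}
    (hB : B ∈ heckeGroup (p ^ 3) A) (hB1 : redSL p B = 1) :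
    ∃ κ : ℂ, U (p ^ 3) B *ᵥ coherentState (heckePoint p A) =
      κ • coherentState (heckePoint p A) := by
  refine IsCoherent.eq_smul hp fun s t => ?_
  -- Write B = 1 + p(x, y; z, w). Divisibility of the lower left entry by p is what makes B preserve
  -- L.
  have hdiv : ∀ i j, ∃ y, B.1 i j - (1 : Matrix (Fin 2) (Fin 2) (ZMod (p ^ 3))) i j = p * y := by
    intro i j
    obtain ⟨y, hy⟩ := exists_of_mul_eq_zero (p := p) (j := 2) (k := 1) rfl (x := B.1 i j -
      (1 : Matrix (Fin 2) (Fin 2) (ZMod (p ^ 3))) i j) (by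
        rw [← red_eq_zero_iff, map_sub, ← redSL_apply, hB1]
        fin_cases i <;> fin_cases j <;> simp)
    exact ⟨y, by rwa [pow_one] at hy⟩
  obtain ⟨x, hx⟩ := hdiv 0 0
  obtain ⟨y, hy⟩ := hdiv 0 1
  obtain ⟨z, hz⟩ := hdiv 1 0
  obtain ⟨w, hw⟩ := hdiv 1 1
  simp only [one_apply_eq, ne_eq, zero_ne_one, one_ne_zero, not_false_eq_true, one_apply_ne,
    sub_zero] at hx hy hz hw
  obtain ⟨-, -, hcomm⟩ := commute_fin_two (mem_heckeGroup hB)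
  simp only [map_apply] at hcomm
  have hdet := B.2
  rw [det_fin_two] at hdet
  have h3 := p_cube (p := p)
  rw [mulVec_mulVec, twOp_mul_U hp, ← mulVec_mulVec]
  have h1 : ![(p : ZMod (p ^ 3)) ^ 2 * s, (p : ZMod (p ^ 3)) * t] ᵥ* B.1 =
      ![(p : ZMod (p ^ 3)) ^ 2 * (s * B.1 0 0 + t * z),
        (p : ZMod (p ^ 3)) * (p * s * B.1 0 1 + t * B.1 1 1)] := by
    ext i
    fin_cases i
    · simp [vecMul, dotProduct, hz]; ring
    · simp [vecMul, dotProduct]; ring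
  -- The change in the phase is p²t(z(d - a) - 2cw). Commutation gives p²z(d - a) = p²c(w - x), and
  -- det B = 1 gives p²(x + w) = 0, so it vanishes. This dictates the choice v = (2c, d - a).
  have hval : (p : ZMod (p ^ 3)) ^ 2 * (s * B.1 0 0 + t * z) * heckePoint p A 1 -
      p * (p * s * B.1 0 1 + t * B.1 1 1) * heckePoint p A 0 =
      (p : ZMod (p ^ 3)) ^ 2 * s * heckePoint p A 1 - p * t * heckePoint p A 0 := by
    simp only [heckePoint, heckeVector, cons_val_zero, cons_val_one]
    push_cast
    rw [eq_add_of_sub_eq hx, eq_add_of_sub_eq hw, hz, hy] at *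
    linear_combination (s * x * (A.1 1 1 - A.1 0 0) - 2 * s * y * A.1 1 0 +
      t * A.1 1 0 * (x * w - y * z)) * h3 - p * t * hcomm - p * t * A.1 1 0 * hdet
  rw [h1, isCoherent_coherentState hp _ _ _, hval, mulVec_smul]

end HeckeGroup

/-! ### Overlaps along the Hecke orbit and the eigenfunction -/

section HeckeEigenfunction

open Matrix

variable {p : ℕ} [Fact p.Prime] {A : SpecialLinearGroup (Fin 2) ℤ}

lemma negOne_mul_negOne (R : Type*) [CommRing R] : negOne R * negOne R = 1 := by
  apply Subtype.ext
  change (-1 : Matrix (Fin 2) (Fin 2) R) * (-1) = 1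
  rw [neg_mul_neg, mul_one]

lemma redSL_inv (B : SpecialLinearGroup (Fin 2) (ZMod (p ^ 3))) (i j : Fin 2) :
    red p ((B⁻¹).1 i j) = ((redSL p B)⁻¹).1 i j := by
  rw [← map_inv, redSL_apply]

lemma vecMul_sub_eq_zero (k : ℤ) {B C : SpecialLinearGroup (Fin 2) (ZMod (p ^ 3))}
    (h : ∀ i, red p (((k : ZMod (p ^ 3)) • heckePoint p A + heckePoint p A ᵥ* (B⁻¹).1 -
      heckePoint p A ᵥ* (C⁻¹).1) i) = 0) :
    ![2 * A.1.map (Int.cast : ℤ → ZMod p) 1 0,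
      A.1.map (Int.cast : ℤ → ZMod p) 1 1 - A.1.map (Int.cast : ℤ → ZMod p) 0 0] ᵥ*
        ((redSL p B)⁻¹.1 + (k : Matrix (Fin 2) (Fin 2) (ZMod p)) - (redSL p C)⁻¹.1) = 0 := by
  have hk : (k : Matrix (Fin 2) (Fin 2) (ZMod p)) = (k : ZMod p) • 1 := by
    rw [Int.cast_smul_eq_zsmul, zsmul_one]
  have h0 := h 0
  have h1 := h 1
  simp only [heckePoint, heckeVector, Pi.sub_apply, Pi.add_apply, Pi.smul_apply, smul_eq_mul,
    vecMul, dotProduct, Fin.sum_univ_two, map_sub, map_add, map_mul, map_intCast, redSL_inv,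
    cons_val_zero, cons_val_one, Int.cast_mul, Int.cast_sub, Int.cast_ofNat, map_ofNat]
    at h0 h1
  rw [hk]
  refine funext (Fin.forall_fin_two.2 ⟨?_, ?_⟩) <;>
    simp only [vecMul, dotProduct, Fin.sum_univ_two, Matrix.sub_apply, Matrix.add_apply,
      Matrix.smul_apply, Pi.zero_apply, map_apply, cons_val_zero, cons_val_one, smul_eq_mul,
      one_apply_eq, ne_eq, zero_ne_one, one_ne_zero, not_false_eq_true, one_apply_ne]
  · linear_combination h0
  · linear_combination h1

lemma commute_redSL_inv {B : SpecialLinearGroup (Fin 2) (ZMod (p ^ 3))}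
    (hB : B ∈ heckeGroup (p ^ 3) A) :
    A.1.map (Int.cast : ℤ → ZMod p) * ((redSL p B)⁻¹).1 =
      ((redSL p B)⁻¹).1 * A.1.map (Int.cast : ℤ → ZMod p) := by
  rw [← map_inv]
  exact commute_redSL (Subgroup.inv_mem _ hB)

/-- The hypotheses on the prime `p`: it is odd, and `A` modulo `p` is regular semisimple with
nonzero lower left entry. -/
structure IsGoodPrime (p : ℕ) (A : SpecialLinearGroup (Fin 2) ℤ) : Prop where
  odd : Odd p
  lower_ne_zero : (A.1 1 0 : ZMod p) ≠ 0
  disc_ne_zero : ((A.1 1 1 : ZMod p) - A.1 0 0) ^ 2 + 4 * A.1 0 1 * A.1 1 0 ≠ 0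

lemma IsGoodPrime.two_ne_zero (h : IsGoodPrime p A) : (2 : ZMod p) ≠ 0 := by
  intro h2
  have : ((2 : ℕ) : ZMod p) = 0 := by exact_mod_cast h2
  rw [ZMod.natCast_eq_zero_iff, Nat.prime_dvd_prime_iff_eq Fact.out Nat.prime_two] at this
  subst this
  exact absurd h.odd (by decide)

/-- A nonzero overlap forces vB⁻¹ + kv = vC⁻¹ modulo p. Both sides come from the commutant of A, for
which v is a separating vector, so the identity lifts to matrices. It is used with k = 0 for
orthogonality and k = 2 for the matrix element. -/
lemma IsGoodPrime.redSL_inv_eq (hp : IsGoodPrime p A) (k : ℤ)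
    {B C : SpecialLinearGroup (Fin 2) (ZMod (p ^ 3))}
    (hB : B ∈ heckeGroup (p ^ 3) A) (hC : C ∈ heckeGroup (p ^ 3) A)
    (h : (twOp (p ^ 3) ((k : ZMod (p ^ 3)) • heckePoint p A) *ᵥ
      (U (p ^ 3) B *ᵥ coherentState (heckePoint p A))) ⬝ᵥ
        star (U (p ^ 3) C *ᵥ coherentState (heckePoint p A)) ≠ 0) :
    (redSL p B)⁻¹.1 + (k : Matrix (Fin 2) (Fin 2) (ZMod p)) = (redSL p C)⁻¹.1 := by
  rw [← sub_eq_zero]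
  refine eq_zero_of_vecMul_eq_zero hp.two_ne_zero hp.lower_ne_zero hp.disc_ne_zero ?_
    (vecMul_sub_eq_zero k (red_eq_of_dotProduct_ne_zero hp.odd.pow
      (isCoherent_coherentState hp.odd.pow _) h))
  rw [mul_sub, mul_add, sub_mul, add_mul, commute_redSL_inv hB, commute_redSL_inv hC,
    (Int.cast_commute k _).eq]

/-- Coherent states at points that differ modulo `p` are orthogonal. -/
lemma IsGoodPrime.redSL_eq (hp : IsGoodPrime p A)
    {B C : SpecialLinearGroup (Fin 2) (ZMod (p ^ 3))}
    (hB : B ∈ heckeGroup (p ^ 3) A) (hC : C ∈ heckeGroup (p ^ 3) A)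
    (h : (U (p ^ 3) B *ᵥ coherentState (heckePoint p A)) ⬝ᵥ
        star (U (p ^ 3) C *ᵥ coherentState (heckePoint p A)) ≠ 0) :
    redSL p B = redSL p C := by
  have := hp.redSL_inv_eq 0 hB hC (by
    rwa [Int.cast_zero, zero_smul, twOp_zero, one_mulVec])
  rw [Int.cast_zero, add_zero] at this
  exact inv_injective (Subtype.ext this)

/-- The only coherent states in the Hecke orbit that are connected by the translation by twice
`heckePoint` are those at `-heckePoint` and at `heckePoint`. -/
lemma IsGoodPrime.redSL_eq_negOne (hp : IsGoodPrime p A)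
    {B C : SpecialLinearGroup (Fin 2) (ZMod (p ^ 3))}
    (hB : B ∈ heckeGroup (p ^ 3) A) (hC : C ∈ heckeGroup (p ^ 3) A)
    (h : (twOp (p ^ 3) ((2 : ZMod (p ^ 3)) • heckePoint p A) *ᵥ
      (U (p ^ 3) B *ᵥ coherentState (heckePoint p A))) ⬝ᵥ
        star (U (p ^ 3) C *ᵥ coherentState (heckePoint p A)) ≠ 0) :
    redSL p B = negOne _ ∧ redSL p C = 1 := by
  have h1 := hp.redSL_inv_eq 2 hB hC (by exact_mod_cast h)
  rw [Int.cast_ofNat] at h1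
  have h2 : ((redSL p B)⁻¹).1 = -1 :=
    eq_neg_one_of_det_add_two hp.two_ne_zero hp.disc_ne_zero (commute_redSL_inv hB)
      (redSL p B)⁻¹.2 (by rw [h1]; exact (redSL p C)⁻¹.2)
  have hneg : (negOne (ZMod p))⁻¹ = negOne _ :=
    inv_eq_of_mul_eq_one_right (negOne_mul_negOne _)
  constructor
  · rw [← _root_.inv_inj, hneg]
    exact Subtype.ext h2
  · rw [← _root_.inv_inj, inv_one]
    apply Subtype.ext
    rw [← h1, h2]
    change (-1 : Matrix (Fin 2) (Fin 2) (ZMod p)) + 2 = 1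
    norm_num

/-- Reflection followed by the translation by `2u` fixes the coherent state at `u` up to sign. -/
lemma twOp_U_negOne_mulVec (hp : Odd (p ^ 3)) (u : Fin 2 → ZMod (p ^ 3)) :
    ∃ κ : ℂ, κ * κ = 1 ∧ twOp (p ^ 3) ((2 : ZMod (p ^ 3)) • u) *ᵥ
      (U (p ^ 3) (negOne _) *ᵥ coherentState u) = κ • coherentState u := by
  have hneg : ∀ m : Fin 2 → ZMod (p ^ 3), m ᵥ* (negOne (ZMod (p ^ 3))).1 = -m := fun m => by
    change m ᵥ* (-1 : Matrix (Fin 2) (Fin 2) (ZMod (p ^ 3))) = -m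
    rw [vecMul_neg, vecMul_one]
  have hco : IsCoherent (-u) (U (p ^ 3) (negOne _) *ᵥ coherentState u) := by
    intro s t
    have h := isCoherent_coherentState hp u (-s) (-t)
    rw [mulVec_mulVec, twOp_mul_U hp, hneg, ← mulVec_mulVec]
    have h1 : -![(p : ZMod (p ^ 3)) ^ 2 * s, (p : ZMod (p ^ 3)) * t] =
        ![(p : ZMod (p ^ 3)) ^ 2 * -s, (p : ZMod (p ^ 3)) * -t] := by
      ext i
      fin_cases i <;> simp
    rw [h1, h, mulVec_smul]
    congr 2
    simp only [Pi.neg_apply]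
    ring_nf
  -- The reflected state sits at -u; the translation by 2u brings it back to u, where the eigenspace
  -- is a line.
  have hco2 := hco.twOp_mulVec hp ((2 : ZMod (p ^ 3)) • u)
  have h2u : -u + (2 : ZMod (p ^ 3)) • u = u := by module
  rw [h2u] at hco2
  obtain ⟨κ, hκ⟩ := hco2.eq_smul hp
  refine ⟨κ, ?_, hκ⟩
  rw [mulVec_mulVec] at hκ
  -- Conjugation by U(-1) inverts the translation, so the product is an involution and its
  -- eigenvalue κ is ±1.
  have hsq : (twOp (p ^ 3) ((2 : ZMod (p ^ 3)) • u) * U (p ^ 3) (negOne _)) *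
      (twOp (p ^ 3) ((2 : ZMod (p ^ 3)) • u) * U (p ^ 3) (negOne _)) = 1 := by
    conv_lhs => enter [1]; rw [twOp_mul_U hp, hneg]
    rw [mul_assoc, ← mul_assoc (twOp _ _), twOp_neg_mul_self hp, one_mul, ← U_mul _ hp,
      negOne_mul_negOne, U_one _ hp]
  have h1 := congrArg (· *ᵥ coherentState u) hsq
  simp only [← mulVec_mulVec] at h1 hκ
  rw [hκ, mulVec_smul, mulVec_smul, hκ, one_mulVec, smul_smul] at h1
  have h0 : (κ * κ - 1) • coherentState u = 0 := by rw [sub_smul, h1, one_smul, sub_self]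
  exact sub_eq_zero.1 ((smul_eq_zero.1 h0).resolve_right (coherentState_ne_zero hp u))

/-- A joint eigenvector of the Hecke operators with a large matrix element. -/
lemma IsGoodPrime.exists_joint_eigenvector (hp : IsGoodPrime p A) :
    ∃ ψ : ZMod (p ^ 3) → ℂ, (∀ B ∈ heckeGroup (p ^ 3) A, ∃ μ : ℂ, U (p ^ 3) B *ᵥ ψ = μ • ψ) ∧
      ∃ (s : ℝ) (ε : ℝ) (g k : ℕ), 0 < s ∧ |ε| = 1 ∧ 0 < g ∧ 0 < k ∧ g ≤ 2 * p * k ∧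
        ψ ⬝ᵥ star ψ = ((g * k * s : ℝ) : ℂ) ∧
        (twOp (p ^ 3) ((2 : ZMod (p ^ 3)) • heckePoint p A) *ᵥ ψ) ⬝ᵥ star ψ =
          ((k ^ 2 * (ε * s) : ℝ) : ℂ) := by
  classical
  have hN : Odd (p ^ 3) := hp.odd.pow
  set φ := coherentState (heckePoint p A) with hφ
  let G := heckeGroup (p ^ 3) A
  let _ : Fintype G := Fintype.ofFinite _
  let r : G →* SpecialLinearGroup (Fin 2) (ZMod p) := (redSL p).comp G.subtype
  obtain ⟨χ, hχ⟩ := exists_monoidHom_sum_ne_zero (G := G)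
    (fun g h => Subtype.ext (heckeGroup_comm hp.lower_ne_zero g.2 h.2))
    (fun g => U (p ^ 3) g.1 *ᵥ φ) (by
      simp only [OneMemClass.coe_one, U_one _ hN, one_mulVec]
      exact coherentState_ne_zero hN _)
  let θ : G → ZMod (p ^ 3) → ℂ := fun g => χ g⁻¹ • (U (p ^ 3) g.1 *ᵥ φ)
  have hχinv : ∀ g, χ g * χ g⁻¹ = 1 := fun g => by
    rw [← map_mul, mul_inv_cancel, map_one]
  have hχ0 : ∀ g, χ g ≠ 0 := fun g h => by simpa [h] using hχinv g
  have hUθ : ∀ g h : G, U (p ^ 3) g.1 *ᵥ θ h = χ g • θ (g * h) := fun g h => by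
    simp only [θ]
    rw [mulVec_smul, mulVec_mulVec, ← U_mul _ hN, smul_smul, _root_.mul_inv_rev, map_mul,
      mul_comm (χ h⁻¹), ← mul_assoc, hχinv, one_mul]
    rfl
  set ψ := ∑ g, θ g with hψ
  have hψ0 : ψ ≠ 0 := hχ
  have heig : ∀ g : G, U (p ^ 3) g.1 *ᵥ ψ = χ g • ψ := fun g => by
    rw [hψ, mulVec_sum, Finset.sum_congr rfl fun h _ => hUθ g h, ← Finset.smul_sum]
    congr 1
    exact Equiv.sum_comp (Equiv.mulLeft g) θ
  -- Substituting hg for h in the sum multiplies ψ by χ(g⁻¹)κ. As ψ ≠ 0, this scalar is 1: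
  -- nonvanishing of ψ alone makes χ match the eigenvalue κ of g on φ.
  have hker : ∀ g : G, r g = 1 → θ g = φ := by
    intro g hg
    obtain ⟨κ, hκ⟩ := U_mulVec_coherentState hN g.2 hg
    have h1 : ∀ h, θ (h * g) = (χ g⁻¹ * κ) • θ h := fun h => by
      simp only [θ, Subgroup.coe_mul]
      rw [U_mul _ hN, ← mulVec_mulVec, hκ, mulVec_smul, smul_smul, smul_smul,
        _root_.mul_inv_rev, map_mul]
      congr 1
      ring
    have h2 : ψ = (χ g⁻¹ * κ) • ψ := by
      conv_lhs => rw [hψ, ← Equiv.sum_comp (Equiv.mulRight g) θ]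
      simp only [Equiv.coe_mulRight, h1, ← Finset.smul_sum, hψ]
    have h3 : χ g⁻¹ * κ = 1 := by
      have : (χ g⁻¹ * κ - 1) • ψ = 0 := by rw [sub_smul, ← h2, one_smul, sub_self]
      exact sub_eq_zero.1 ((smul_eq_zero.1 this).resolve_right hψ0)
    simp only [θ]
    rw [hκ, smul_smul, h3, one_smul]
  have hθ : ∀ g h, r g = r h → θ g = θ h := by
    intro g h hgh
    have h1 : θ (h⁻¹ * g) = φ := hker _ (by rw [map_mul, map_inv, hgh, inv_mul_cancel])
    have h2 : θ (h⁻¹ * h) = φ := hker _ (by rw [inv_mul_cancel, map_one])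
    have e1 := hUθ h (h⁻¹ * g)
    have e2 := hUθ h (h⁻¹ * h)
    rw [mul_inv_cancel_left] at e1 e2
    rw [h1] at e1
    rw [h2, e1] at e2
    exact smul_right_injective _ (hχ0 h) e2
  have hθne : ∀ (W : Matrix (ZMod (p ^ 3)) (ZMod (p ^ 3)) ℂ) (g h : G),
      (W *ᵥ θ g) ⬝ᵥ star (θ h) ≠ 0 →
        (W *ᵥ (U (p ^ 3) g.1 *ᵥ φ)) ⬝ᵥ star (U (p ^ 3) h.1 *ᵥ φ) ≠ 0 := by
    intro W g h h0 h1
    apply h0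
    simp only [θ]
    rw [mulVec_smul, smul_dotProduct, star_smul, dotProduct_smul, h1, smul_zero, smul_zero]
  let s : ℝ := ∑ y, ‖φ y‖ ^ 2
  have hs : φ ⬝ᵥ star φ = (s : ℂ) := by
    simp only [dotProduct, Pi.star_apply, s, Complex.ofReal_sum, Complex.ofReal_pow]
    exact Finset.sum_congr rfl fun y _ => Complex.mul_conj' _
  have hspos : 0 < s := by
    refine lt_of_le_of_ne (Finset.sum_nonneg fun y _ => by positivity) fun h0 => ?_
    apply coherentState_ne_zero hN (heckePoint p A)
    ext y
    have := (Finset.sum_eq_zero_iff_of_nonneg fun y _ => by positivity).1 h0.symm y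
      (Finset.mem_univ y)
    simpa using this
  have hθs : ∀ g, θ g ⬝ᵥ star (θ g) = (s : ℂ) := by
    intro g
    simp only [θ]
    rw [smul_dotProduct, star_smul, dotProduct_smul, mulVec_dotProduct_star_mulVec
      (mul_eq_one_comm.1 (U_mul_star _ hN g.1)), hs, smul_smul, smul_eq_mul]
    have : χ g⁻¹ * star (χ g⁻¹) = 1 := by
      rw [Complex.star_def, Complex.mul_conj', norm_monoidHom_apply]
      simp
    rw [this, one_mul]
  set k := (Finset.univ.filter fun g => r g = 1).card with hk
  let a : G := ⟨negOne _, negOne_mem_heckeGroup _⟩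
  obtain ⟨κ, hκ, hκφ⟩ := twOp_U_negOne_mulVec hN (heckePoint p A)
  rw [← hφ] at hκφ
  have hχa : χ a⁻¹ * χ a⁻¹ = 1 := by
    have : a * a = 1 := Subtype.ext (negOne_mul_negOne _)
    rw [← map_mul, ← _root_.mul_inv_rev, this, inv_one, map_one]
  have hnorm := sum_dotProduct_star_sum r θ hθ (fun g h h0 => hp.redSL_eq g.2 h.2 (by
    have := hθne 1 g h (by rwa [one_mulVec])
    rwa [one_mulVec] at this)) hθs
  have hmat := mulVec_sum_dotProduct_star_sum r θ hθ
    (twOp (p ^ 3) ((2 : ZMod (p ^ 3)) • heckePoint p A)) a (fun g h h0 => by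
      have := hp.redSL_eq_negOne g.2 h.2 (hθne _ g h h0)
      rwa [← redSL_negOne] at this)
  -- Both factors square to 1, so the surviving term is real. This prevents cancellation when the
  -- adjoint is added to form the cosine.
  have hε : ∃ ε : ℝ, |ε| = 1 ∧ χ a⁻¹ * κ = (ε : ℂ) := by
    have : (χ a⁻¹ * κ) * (χ a⁻¹ * κ) = 1 := by
      linear_combination hχa * κ * κ + hκ
    rcases mul_self_eq_one_iff.1 this with h | h
    · exact ⟨1, by simp, by rw [h, Complex.ofReal_one]⟩
    · exact ⟨-1, by simp, by rw [h, Complex.ofReal_neg, Complex.ofReal_one]⟩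
  obtain ⟨ε, hε1, hε⟩ := hε
  refine ⟨ψ, fun B hB => ⟨χ ⟨B, hB⟩, heig ⟨B, hB⟩⟩, s, ε, Fintype.card G, k, hspos, hε1,
    Fintype.card_pos, ?_, ?_, ?_, ?_⟩
  · exact Finset.card_pos.2 ⟨1, by simp⟩
  -- The image modulo p centralizes A in SL(2, 𝔽_p), hence has at most 2p elements, and every fiber
  -- has k elements.
  · refine (card_le_mul_card_fiber r).trans (Nat.mul_le_mul_right _ ?_)
    have := card_centralizer_le (A := A.1.map (Int.cast : ℤ → ZMod p)) hp.lower_ne_zero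
      (Finset.univ.image r) (by
        intro B hB
        obtain ⟨g, -, rfl⟩ := Finset.mem_image.1 hB
        exact commute_redSL g.2)
    rwa [ZMod.card] at this
  · rw [hnorm]
    push_cast
    rfl
  · rw [hmat, hker 1 (map_one r)]
    simp only [θ]
    rw [mulVec_smul, hκφ, smul_smul, hε, smul_dotProduct, hs]
    push_cast
    rfl

end HeckeEigenfunction

/-! ### Normalisation and the lower bound -/

section SlowDecay

open Matrix

variable {p : ℕ} [Fact p.Prime] {A : SpecialLinearGroup (Fin 2) ℤ}

/-- For an even frequency the sign (-1)^(n₁n₂) is trivial, so no twist appears. -/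
lemma elemOp_two_smul {N : ℕ} [NeZero N] (hN : Odd N) (n : Fin 2 → ℤ) :
    elemOp N ((2 : ℤ) • n) = twOp N ((2 : ZMod N) • fun i => (n i : ZMod N)) := by
  have h := twOp_intCast N hN ((2 : ℤ) • n)
  have he : Even (((2 : ℤ) • n) 0 * ((2 : ℤ) • n) 1) := by
    simp only [Pi.smul_apply, smul_eq_mul]
    exact (even_two_mul _).mul_right _
  rw [he.neg_one_zpow, one_smul] at h
  rw [← h]
  congr 1
  ext i
  simp

/-- The frequency -2n contributes the adjoint, hence the conjugate matrix element; as x is real, the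
two add up to 2x. -/
lemma matrixElement_smul_cosObservable {N : ℕ} [NeZero N] (hN : Odd N) (n : Fin 2 → ℤ)
    (ψ : ZMod N → ℂ) {x : ℝ}
    (h : (twOp N ((2 : ZMod N) • fun i => (n i : ZMod N)) *ᵥ ψ) ⬝ᵥ star ψ = (x : ℂ)) (t : ℝ) :
    matrixElement N (cosObservable ((2 : ℤ) • n)) ((t : ℂ) • ψ) =
      ((t ^ 2 * (2 * x) / N : ℝ) : ℂ) := by
  have hneg : elemOp N (-((2 : ℤ) • n)) =
      (twOp N ((2 : ZMod N) • fun i => (n i : ZMod N)))ᴴ := by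
    rw [← smul_neg, elemOp_two_smul hN, twOp_star N hN]
    congr 1
    ext i
    simp
  have h2 : ((twOp N ((2 : ZMod N) • fun i => (n i : ZMod N)))ᴴ *ᵥ ψ) ⬝ᵥ star ψ = (x : ℂ) := by
    rw [mulVec_dotProduct_star, conjTranspose_conjTranspose, dotProduct_star, h,
      Complex.star_def, Complex.conj_ofReal]
  have h3 : matrixElement N (cosObservable ((2 : ℤ) • n)) ((t : ℂ) • ψ) = (1 / (N : ℂ)) *
      ((Op N (cosObservable ((2 : ℤ) • n)) *ᵥ ((t : ℂ) • ψ)) ⬝ᵥ star ((t : ℂ) • ψ)) := rfl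
  rw [h3, Op_cosObservable, hneg, elemOp_two_smul hN, mulVec_smul, add_mulVec, star_smul,
    smul_dotProduct, dotProduct_smul, add_dotProduct, h, h2]
  simp only [smul_eq_mul, Complex.star_def, Complex.conj_ofReal]
  push_cast
  ring

lemma IsGoodPrime.exists_isHeckeEigenfunction (hp : IsGoodPrime p A) :
    ∃ ψ : ZMod (p ^ 3) → ℂ, IsHeckeEigenfunction (p ^ 3) A ψ ∧
      (p : ℝ)⁻¹ ≤ ‖matrixElement (p ^ 3) (cosObservable ((2 : ℤ) • heckeVector A)) ψ‖ := by
  obtain ⟨ψ, heig, s, ε, g, k, hs, hε, hg, hk, hgk, hnorm, hmat⟩ := hp.exists_joint_eigenvector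
  have hp0 : (0 : ℝ) < p := by exact_mod_cast (Fact.out : p.Prime).pos
  have hN0 : (0 : ℝ) < ((p ^ 3 : ℕ) : ℝ) := by exact_mod_cast pow_pos (Fact.out : p.Prime).pos 3
  have hg0 : (0 : ℝ) < g := by exact_mod_cast hg
  have hk0 : (0 : ℝ) < k := by exact_mod_cast hk
  have hgk' : (g : ℝ) ≤ 2 * p * k := by exact_mod_cast hgk
  -- This scaling makes ψ a unit vector for the 1/N-weighted inner product; the factors N and s then
  -- cancel and the matrix element is ±2k/g, with g ≤ 2pk.
  set t : ℝ := Real.sqrt (((p ^ 3 : ℕ) : ℝ) / (g * k * s)) with ht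
  have ht2 : t ^ 2 = ((p ^ 3 : ℕ) : ℝ) / (g * k * s) := Real.sq_sqrt (by positivity)
  refine ⟨(t : ℂ) • ψ, ⟨?_, fun B hB => ?_⟩, ?_⟩
  · have h : stateInner (p ^ 3) ((t : ℂ) • ψ) ((t : ℂ) • ψ) =
        (1 / ((p ^ 3 : ℕ) : ℂ)) * (((t : ℂ) • ψ) ⬝ᵥ star ((t : ℂ) • ψ)) := rfl
    have h1 : 1 / ((p ^ 3 : ℕ) : ℝ) * (t ^ 2 * (g * k * s)) = 1 := by
      rw [ht2]
      field_simp
    have h2 := congrArg (fun x : ℝ => (x : ℂ)) h1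
    rw [h, star_smul, smul_dotProduct, dotProduct_smul, hnorm]
    simp only [smul_eq_mul, Complex.star_def, Complex.conj_ofReal]
    push_cast at h2 ⊢
    linear_combination h2
  · obtain ⟨μ, hμ⟩ := heig B hB
    exact ⟨μ, by rw [mulVec_smul, hμ, smul_comm]⟩
  · rw [matrixElement_smul_cosObservable hp.odd.pow (heckeVector A) ψ hmat t, Complex.norm_real,
      ht2]
    have h1 : ((p ^ 3 : ℕ) : ℝ) / (g * k * s) * (2 * (k ^ 2 * (ε * s))) / ((p ^ 3 : ℕ) : ℝ) =
        2 * k / g * ε := by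
      field_simp
    rw [h1, Real.norm_eq_abs, abs_mul, hε, mul_one, abs_of_pos (by positivity), inv_eq_one_div,
      div_le_div_iff₀ hp0 hg0]
    linarith

/-- If c = 0, the diagonal entries are equal units and the trace is ±2; the second quantity equals
tr(A)² - 4. -/
lemma ne_zero_of_hyperbolic (hA : 2 < |Matrix.trace (A : Matrix (Fin 2) (Fin 2) ℤ)|) :
    A.1 1 0 ≠ 0 ∧ (A.1 1 1 - A.1 0 0) ^ 2 + 4 * A.1 0 1 * A.1 1 0 ≠ 0 := by
  have hdet := A.2
  rw [det_fin_two] at hdet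
  have htr : 2 < |A.1 0 0 + A.1 1 1| := by rwa [trace_fin_two] at hA
  have hsq : 2 ^ 2 < (A.1 0 0 + A.1 1 1) ^ 2 := sq_lt_sq.2 (by simpa using htr)
  refine ⟨fun hc => ?_, fun h => ?_⟩
  · rw [hc, mul_zero, sub_zero] at hdet
    rcases Int.mul_eq_one_iff_eq_one_or_neg_one.1 hdet with ⟨h0, h1⟩ | ⟨h0, h1⟩ <;>
      rw [h0, h1] at htr <;> norm_num at htr
  · have : (A.1 0 0 + A.1 1 1) ^ 2 = 2 ^ 2 := by linear_combination h + 4 * hdet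
    exact hsq.ne' this

lemma intCast_ne_zero_of_natAbs_lt {x : ℤ} (hx : x ≠ 0) (h : x.natAbs < p) : (x : ZMod p) ≠ 0 := by
  rw [Ne, ZMod.intCast_zmod_eq_zero_iff_dvd, Int.natCast_dvd]
  exact fun hd => absurd (Nat.le_of_dvd (Int.natAbs_pos.2 hx) hd) h.not_ge

end SlowDecay

end CatMap

end

theorem theorem2 (A : Matrix.SpecialLinearGroup (Fin 2) ℤ)
    (hA : 2 < |Matrix.trace (A : Matrix (Fin 2) (Fin 2) ℤ)|) :
    ∃ f : CatMap.Torus → ℝ, CatMap.IsSmooth f ∧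
      ∃ c : ℝ, 0 < c ∧ ∃ p₀ : ℕ, ∀ (p : ℕ) [Fact p.Prime], p₀ ≤ p →
        ∃ ψ : ZMod (p ^ 3) → ℂ, CatMap.IsHeckeEigenfunction (p ^ 3) A ψ ∧
          c * ((p ^ 3 : ℕ) : ℝ) ^ (-(1 / 3) : ℝ) ≤
            ‖CatMap.matrixElement (p ^ 3) f ψ - (CatMap.average f : ℂ)‖ := by
  obtain ⟨hc, hdisc⟩ := CatMap.ne_zero_of_hyperbolic hA
  have hn : (2 : ℤ) • CatMap.heckeVector A ≠ 0 := fun h => by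
    have := congrFun h 0
    simp [CatMap.heckeVector] at this
    exact hc this
  refine ⟨CatMap.cosObservable ((2 : ℤ) • CatMap.heckeVector A),
    CatMap.isSmooth_cosObservable _, 1, one_pos,
    -- Primes beyond this bound exceed |c| and the absolute discriminant, so they divide neither;
    -- the 3 excludes p = 2.
    (A.1 1 0).natAbs + ((A.1 1 1 - A.1 0 0) ^ 2 + 4 * A.1 0 1 * A.1 1 0).natAbs + 3, ?_⟩
  intro p hp hple
  have hgood : CatMap.IsGoodPrime p A :=
    { odd := hp.out.odd_of_ne_two (by omega)
      lower_ne_zero := CatMap.intCast_ne_zero_of_natAbs_lt hc (by omega)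
      disc_ne_zero := by
        have := CatMap.intCast_ne_zero_of_natAbs_lt (p := p) hdisc (by omega)
        push_cast at this
        exact this }
  obtain ⟨ψ, hψ, hle⟩ := hgood.exists_isHeckeEigenfunction
  refine ⟨ψ, hψ, ?_⟩
  rw [CatMap.average_cosObservable hn, Complex.ofReal_zero, sub_zero, one_mul]
  refine le_trans (le_of_eq ?_) hle
  have hp0 : (0 : ℝ) ≤ p := Nat.cast_nonneg p
  rw [Nat.cast_pow, ← Real.rpow_natCast, ← Real.rpow_mul hp0]
  norm_num
  exact Real.rpow_neg_one _
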